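/- For $u>0$ let $\mathcal S^{\mathrm{PI}}(u)$ be the Painlevé I spectral curve $x(z)=z^2-2u$, $y(z)=z^3-3uz$, $\omega_{0,2}(z_1,z_2)=\frac{dz_1\,dz_2}{(z_1-z_2)^2}$. Put $\theta(z)=\frac{-2}{(y(z)-y(-z))\,dx(z)}=\bigl(\sum_{m\ge0}\theta_m z^{2m-2}\bigr)\frac1{dz}$, $e_i(z)=\frac{z^{2i+1}}{(2i+1)!!}$, $\xi^i(z)=\operatorname{Res}_{w=0}\bigl(\int_0^w\omega_{0,2}(z,\cdot)\bigr)\frac{(2i+1)!!\,dw}{w^{2i+2}}$, and $$A_{i,j,k}=\operatorname*{Res}_{z=0}\theta\,e_i\,de_j\,de_k,\quad B_{i,j}^{k}=\operatorname*{Res}_{z=0}\theta\,e_i\,de_j\,\xi^k,\quad C_i^{j,k}=\operatorname*{Res}_{z=0}\theta\,e_i\,\xi^j\,\xi^k,\quad D_i=\delta_{i,0}\tfrac{\theta_1}{8}+\delta_{i,1}\tfrac{\theta_0}{24}.$$ For $n\ge1$ and $k_1,\dots,k_n\ge0$ the amplitudes $F^{\mathrm{PI}}_{g;k_1,\dots,k_n}(u)$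 are defined by $F_{0;i}=F_{0;i,j}=0$, $F_{0;i,j,k}=A_{i,j,k}$, $F_{1;i}=D_i$ and, for all other $(g,n)$ with $2g-2+n>0$, $$F_{g;k_1,\dots,k_n}=\sum_{m=2}^n\sum_{\mu\ge0}B_{k_1,k_m}^{\mu}F_{g;\mu,k_2,\dots,\widehat{k_m},\dots,k_n}+\frac12\sum_{\mu,\nu\ge0}C_{k_1}^{\mu,\nu}\Bigl(F_{g-1;\mu,\nu,k_2,\dots,k_n}+\sum_{\substack{g_1+g_2=g\\ I_1\sqcup I_2=\{k_2,\dots,k_n\}}}F_{g_1;\mu,I_1}F_{g_2;\nu,I_2}\Bigr),$$ where $F_{g-1;\dots}$ is read as $0$ if $g=0$; for $n=0$ and $g\ge2$, $F^{\mathrm{PI}}_g(u)=\frac1{2-2g}\operatorname{Res}_{z=0}\bigl(\int_0^z y\,dx\bigr)\sum_{k\ge0}F^{\mathrm{PI}}_{g;k}(u)\,\xi^k(z)$. Finally let $$P(u)=\begin{cases}\dfrac{2}{5u^2}&\text{if }u<\tfrac25,\\[2mm]\dfrac{5}{10u-2}&\text{if }u\ge\tfrac25.\end{cases}$$ **Proposition.**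 There exists a function $S:(0,\infty)\to(0,\infty)$ such that the following two bounds hold for every $u>0$ and all integers $g,n\ge0$ with $2g-2+n>0$. 1. For all $k_1,\dots,k_n\ge0$, $$F^{\mathrm{PI}}_{g;k_1,\dots,k_n}(u)\prod_{i=1}^n(2k_i+1)!!\le S(u)\Bigl(\frac{2u}{27}\Bigr)^gP(u)^{3g-3+n}\,\frac{(3g-3+n)!}{g!}.$$ 2. With the same function $S$, for every $v>0$ the following series converges absolutely and, writing $|k|=k_1+\cdots+k_n$, $$\sum_{k_1,\dots,k_n\ge0}v^{-|k|}F^{\mathrm{PI}}_{g;k_1,\dots,k_n}(u)\prod_{i=1}^n(2k_i+1)!!\le\frac{S(u/v)}{v}\Bigl(\frac{2u}{27}\Bigr)^g\Bigl(\frac{P(u/v)}{v^2}\Bigr)^{3g-3+n}\frac{(3g-3+2n)!}{g!\,n!}.$$ -/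

import Mathlib

namespace TopRec

noncomputable section

/-- A local spectral curve with exactly one ramification point, at the origin of a
coordinate `z` with `x = x₀ + z²` and with real expansion coefficients.
It records the constant `x₀`, the expansion of `y`, and the coefficients of
the regular part of the bidifferential
`ω₀₂(z, w) = (1 / (z - w)² + ∑ reg m n zᵐ wⁿ) dz dw`. -/
structure LocalSpectralCurve where
  x₀ : ℝ
  y : PowerSeries ℝ
  reg : ℕ → ℕ → ℝ
  reg_symm : ∀ m n, reg m n = reg n m

/-- The formal primitive without constant term. -/
def primitive {K : Type*} [Field K] (f : PowerSeries K) : PowerSeries K :=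
  PowerSeries.mk fun n => if n = 0 then 0 else PowerSeries.coeff (n - 1) f / (n : K)

/-- The residue at the origin of the one-form `f(z) dz`. -/
def residue {K : Type*} [Field K] (f : LaurentSeries K) : K :=
  f.coeff (-1)

namespace LocalSpectralCurve

variable (S : LocalSpectralCurve)

/-- The function `x = x₀ + z²`. -/
def x : PowerSeries ℝ :=
  PowerSeries.C S.x₀ + PowerSeries.X ^ 2

/-- The series `f` in `θ(z) = -2 / ((y(z) - y(-z)) dx(z)) = f(z) / dz`. -/
def theta : LaurentSeries ℝ :=
  -2 / (HahnSeries.ofPowerSeries ℤ ℝ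
    ((S.y - PowerSeries.evalNegHom S.y) * PowerSeries.derivative ℝ S.x))

/-- The expansion coefficients `θₘ` in `θ(z) = (∑ θₘ z^(2m-2)) / dz`. -/
def thetaCoeff (m : ℕ) : ℝ :=
  S.theta.coeff (2 * (m : ℤ) - 2)

/-- The expansion coefficients `φ_{m,n}` of the even part of the regular part of `ω₀₂`. -/
def phiCoeff (m n : ℕ) : ℝ :=
  S.reg (2 * m) (2 * n)

/-- The expansion of `ω₀₂(z, w) / (dz dw)` for `w` near `0`, as a power series in `w` whose
coefficients are Laurent series in `z`. -/
def omega02 : PowerSeries (LaurentSeries ℝ) :=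
  ((PowerSeries.C (HahnSeries.single (1 : ℤ) (1 : ℝ)) - PowerSeries.X) ^ 2)⁻¹ +
    PowerSeries.mk fun n =>
      HahnSeries.ofPowerSeries ℤ ℝ (PowerSeries.mk fun m => S.reg m n)

/-- The function `eᵢ(z) = z^(2i+1) / (2i+1)!!`. -/
def e (i : ℕ) : PowerSeries ℝ :=
  PowerSeries.monomial (2 * i + 1) (1 / (Nat.doubleFactorial (2 * i + 1) : ℝ))

/-- The differential `ξⁱ(z) = Res_{w = 0} (∫_0^w ω₀₂(z, ·)) (2i+1)!! dw / w^(2i+2)`,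
divided by `dz`. -/
def xi (i : ℕ) : LaurentSeries ℝ :=
  residue (HahnSeries.ofPowerSeries ℤ (LaurentSeries ℝ) (primitive S.omega02) *
    HahnSeries.single (-(2 * (i : ℤ) + 2))
      (Nat.doubleFactorial (2 * i + 1) : LaurentSeries ℝ))

/-- `A_{i,j,k} = Res θ eᵢ deⱼ deₖ`. -/
def A (i j k : ℕ) : ℝ :=
  residue (S.theta * HahnSeries.ofPowerSeries ℤ ℝ
    (e i * PowerSeries.derivative ℝ (e j) * PowerSeries.derivative ℝ (e k)))

/-- `B i j k` is `B_{i,j}^k = Res θ eᵢ deⱼ ξᵏ`. -/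
def B (i j k : ℕ) : ℝ :=
  residue (S.theta * HahnSeries.ofPowerSeries ℤ ℝ
    (e i * PowerSeries.derivative ℝ (e j)) * S.xi k)

/-- `C i j k` is `C_i^{j,k} = Res θ eᵢ ξʲ ξᵏ`. -/
def C (i j k : ℕ) : ℝ :=
  residue (S.theta * HahnSeries.ofPowerSeries ℤ ℝ (e i) * S.xi j * S.xi k)

/-- `Dᵢ = δ_{i,0} (θ₀ φ_{0,0} / 2 + θ₁ / 8) + δ_{i,1} θ₀ / 24`. -/
def D (i : ℕ) : ℝ :=
  (if i = 0 then S.thetaCoeff 0 / 2 * S.phiCoeff 0 0 + S.thetaCoeff 1 / 8 else 0) +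
    (if i = 1 then S.thetaCoeff 0 / 24 else 0)

end LocalSpectralCurve

/-- The sublist of `L` formed by the entries whose position lies in `I`. -/
def sublistAt (L : List ℕ) (I : Finset (Fin L.length)) : List ℕ :=
  ((List.finRange L.length).filter (fun m => decide (m ∈ I))).map L.get

theorem length_sublistAt (L : List ℕ) (I : Finset (Fin L.length)) :
    (sublistAt L I).length = I.card := by
  have h : ((List.finRange L.length).filter (fun m => decide (m ∈ I))).toFinset = I := by
    ext m; simp
  rw [sublistAt, List.length_map, ← List.toFinset_card_of_nodup
    ((List.nodup_finRange _).filter _), h]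

/-- The amplitudes `F_{g; k₁, …, kₙ}` with `n ≥ 1` of the quantum Airy structure `(A, B, C, D)`
of a local spectral curve, given by the recursion
`F_{g; k₁, …, kₙ} = ∑_{m ≥ 2} ∑_μ B_{k₁,kₘ}^μ F_{g; μ, k₂, …, k̂ₘ, …, kₙ}`
`+ ½ ∑_{μ,ν} C_{k₁}^{μ,ν} (F_{g-1; μ, ν, k₂, …, kₙ} + ∑ F_{g₁; μ, I₁} F_{g₂; ν, I₂})`,
where the last sum runs over `g₁ + g₂ = g` and `I₁ ⊔ I₂ = {k₂, …, kₙ}`, with the initial values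
`F_{0; i} = F_{0; i, j} = 0`, `F_{0; i, j, k} = A_{i,j,k}` and `F_{1; i} = Dᵢ`.
In the last sum only the products with a factor `F_{0; μ}` or `F_{0; ν}` are left out; these
vanish. The value on the empty list is a placeholder. -/
def airyAmplitude (S : LocalSpectralCurve) (g : ℕ) : List ℕ → ℝ
  | [] => 0
  | a :: L =>
    if g = 0 ∧ L.length ≤ 1 then 0
    else if g = 0 ∧ L.length = 2 then S.A a (L.getD 0 0) (L.getD 1 0)
    else if g = 1 ∧ L.length = 0 then S.D a
    else
      (∑ m : Fin L.length, ∑ᶠ μ : ℕ,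
        S.B a (L.get m) μ * airyAmplitude S g (μ :: L.eraseIdx m)) +
      1 / 2 * ∑ᶠ p : ℕ × ℕ, S.C a p.1 p.2 *
        ((if _hg : 1 ≤ g then airyAmplitude S (g - 1) (p.1 :: p.2 :: L) else 0) +
          ∑ g₁ : Fin (g + 1), ∑ I : Finset (Fin L.length),
            if _h : (1 ≤ (g₁ : ℕ) ∨ 1 ≤ I.card) ∧ (1 ≤ g - (g₁ : ℕ) ∨ 1 ≤ Iᶜ.card) then
              airyAmplitude S (g₁ : ℕ) (p.1 :: sublistAt L I) *
                airyAmplitude S (g - (g₁ : ℕ)) (p.2 :: sublistAt L Iᶜ)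
            else 0)
termination_by L => 2 * g + L.length
decreasing_by
  · have := m.isLt
    simp only [List.length_cons, List.length_eraseIdx, this, if_true]
    omega
  · simp only [List.length_cons]
    omega
  all_goals
    have h1 := g₁.isLt
    have h2 := Finset.card_add_card_compl I
    rw [Fintype.card_fin] at h2
    simp only [List.length_cons, length_sublistAt]
    omega

/-- The correlator `ω_{g,1}(z) = ∑_k F_{g; k} ξᵏ(z)`, divided by `dz`. -/
def omega1 (S : LocalSpectralCurve) (g : ℕ) : LaurentSeries ℝ :=
  ∑ᶠ k : ℕ, airyAmplitude S g [k] • S.xi k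

/-- The free energy `F_g = (2 - 2g)⁻¹ Res_{z = 0} (∫_0^z y dx) ω_{g,1}(z)`, for `g ≥ 2`. -/
def freeEnergy (S : LocalSpectralCurve) (g : ℕ) : ℝ :=
  1 / (2 - 2 * (g : ℝ)) *
    residue (HahnSeries.ofPowerSeries ℤ ℝ
      (primitive (S.y * PowerSeries.derivative ℝ S.x)) * omega1 S g)

/-- The amplitude `F_{g; k₁, …, kₙ}`, which for `n = 0` is the free energy `F_g`. -/
def amplitude (S : LocalSpectralCurve) (g : ℕ) {n : ℕ} (k : Fin n → ℕ) : ℝ :=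
  if n = 0 then freeEnergy S g else airyAmplitude S g (List.ofFn k)

/-- The Painlevé I spectral curve `x = z² - 2u`, `y = z³ - 3uz`,
`ω₀₂ = dz₁ dz₂ / (z₁ - z₂)²`. -/
def painleveI (u : ℝ) : LocalSpectralCurve where
  x₀ := -2 * u
  y := PowerSeries.X ^ 3 - PowerSeries.C (3 * u) * PowerSeries.X
  reg := fun _ _ => 0
  reg_symm := fun _ _ => rfl

/-- The function `P(u)`, equal to `2 / (5u²)` for `u < 2/5` and to `5 / (10u - 2)` for
`u ≥ 2/5`. -/
def growthP (u : ℝ) : ℝ :=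
  if u < 2 / 5 then 2 / (5 * u ^ 2) else 5 / (10 * u - 2)

end

end TopRec

/-!
After multiplication by `(6u) ^ (2g - 2 + n) ∏ (2kᵢ + 1)!!` the amplitudes of the curve satisfy the
Virasoro constraints of the Witten–Kontsevich partition function with the time `t₁` shifted by
`a = 1 / (3u)`: the geometric series in the residues with `θ` is the resolved form of the shift
term. The constraints imply the string equation, because its defect satisfies a homogeneous linear
recursion and vanishes when the head index is large.

The string equation removes a vanishing index, and the recursion removes a positive one. Let
`ℓ = 3g - 3 + n - |k|`. By induction on `n + ℓ` every amplitude with `n` indices is at most a genus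
constant times `3 ^ n (q ^ ℓ / ℓ!) (2g + n + ℓ - 3)!`, where `q = 1 / (5u)`. When no index vanishes,
genus zero factors drop out of the quadratic term, so that the genus constants close up in a
convolution inequality. The binomial theorem turns `q ^ ℓ (M + ℓ)! / ℓ!` into the rate `P(u)`, and
`|k| ≤ 3g - 3 + n` turns the sum over all `k` into a binomial coefficient.
-/

namespace TopRec

noncomputable section

open Finset.HasAntidiagonal (antidiagonal mem_antidiagonal)
open PowerSeries (derivative evalNegHom expand invUnitsSub)
open scoped Nat

/-! ### Calculus of functions on multisets -/

section MultisetCalculus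

variable {R α : Type*} [CommRing R]

/-- The derivative `∂/∂tₓ`. A function `χ` on multisets encodes the generating function
`∑ χ(s) ∏ tₓ ^ mₓ / mₓ!` over all multisets `s`, where `mₓ` is the multiplicity of `x` in `s`. -/
def pderiv (x : α) : (Multiset α → R) →ₗ[R] (Multiset α → R) :=
  LinearMap.funLeft R R (x ::ₘ ·)

@[simp] theorem pderiv_apply (x : α) (χ : Multiset α → R) (s : Multiset α) :
    pderiv x χ s = χ (x ::ₘ s) := rfl

theorem pderiv_comm (x y : α) (χ : Multiset α → R) :
    pderiv x (pderiv y χ) = pderiv y (pderiv x χ) := by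
  ext s
  simp only [pderiv_apply, Multiset.cons_swap]

/-- The product of generating functions: the convolution over all splittings of a multiset into
two parts. -/
def conv : (Multiset α → R) →ₗ[R] (Multiset α → R) →ₗ[R] (Multiset α → R) :=
  LinearMap.mk₂ R (fun χ ψ s => (s.antidiagonal.map fun t => χ t.1 * ψ t.2).sum)
    (fun _ _ _ => by ext; simp [add_mul])
    (fun _ _ _ => by ext; simp [mul_assoc, Multiset.sum_map_mul_left])
    (fun _ _ _ => by ext; simp [mul_add])
    (fun _ _ _ => by ext; simp [mul_left_comm, Multiset.sum_map_mul_left])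

theorem conv_apply (χ ψ : Multiset α → R) (s : Multiset α) :
    conv χ ψ s = (s.antidiagonal.map fun t => χ t.1 * ψ t.2).sum := rfl

@[simp] theorem conv_apply_zero (χ ψ : Multiset α → R) : conv χ ψ 0 = χ 0 * ψ 0 := by
  simp [conv_apply]

theorem pderiv_conv (x : α) (χ ψ : Multiset α → R) :
    pderiv x (conv χ ψ) = conv (pderiv x χ) ψ + conv χ (pderiv x ψ) := by
  ext s
  simp [conv_apply, Multiset.antidiagonal_cons, Multiset.map_map, add_comm]

theorem conv_comm (χ ψ : Multiset α → R) : conv χ ψ = conv ψ χ := by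
  ext s
  induction s using Multiset.induction generalizing χ ψ with
  | empty => simp [mul_comm]
  | cons x s ih =>
    change pderiv x (conv χ ψ) s = pderiv x (conv ψ χ) s
    rw [pderiv_conv, pderiv_conv, Pi.add_apply, Pi.add_apply, ih, ih χ, add_comm]

theorem conv_apply_eq_zero {χ ψ : Multiset α → R} {s : Multiset α}
    (h : ∀ t₁ t₂, t₁ + t₂ = s → χ t₁ * ψ t₂ = 0) : conv χ ψ s = 0 := by
  rw [conv_apply, Multiset.map_congr rfl fun t ht => h _ _ (Multiset.mem_antidiagonal.1 ht),
    Multiset.sum_map_zero]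

theorem conv_apply_eq_mul {χ ψ χ' ψ' : Multiset α → R} {s : Multiset α} {c : R}
    (h : ∀ t₁ t₂, t₁ + t₂ = s → χ' t₁ * ψ' t₂ = c * (χ t₁ * ψ t₂)) :
    conv χ' ψ' s = c * conv χ ψ s := by
  rw [conv_apply, conv_apply, ← Multiset.sum_map_mul_left]
  exact congrArg _ (Multiset.map_congr rfl fun t ht => h _ _ (Multiset.mem_antidiagonal.1 ht))

theorem sum_conv_apply {ι : Type*} (A : Finset ι) (χ ψ : ι → Multiset α → R) (s : Multiset α) :
    ∑ i ∈ A, conv (χ i) (ψ i) s = (s.antidiagonal.map fun t => ∑ i ∈ A, χ i t.1 * ψ i t.2).sum :=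
  Multiset.sum_map_sum.symm

variable [DecidableEq α]

theorem pderiv_single (x : α) (s : Multiset α) (c : R) :
    pderiv x (Pi.single s c) = if x ∈ s then Pi.single (s.erase x) c else 0 := by
  ext t
  split_ifs with hx
  · rw [pderiv_apply, ← Multiset.cons_erase hx, Multiset.erase_cons_head, Pi.single_apply,
      Pi.single_apply]
    simp only [Multiset.cons_inj_right]
  · have hne : x ::ₘ t ≠ s := fun h => hx (h ▸ Multiset.mem_cons_self x t)
    rw [pderiv_apply, Pi.zero_apply, Pi.single_eq_of_ne hne]

theorem conv_one (ψ : Multiset α → R) : conv (Pi.single 0 1) ψ = ψ := by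
  ext s
  induction s using Multiset.induction generalizing ψ with
  | empty => simp
  | cons x s ih =>
    change pderiv x (conv (Pi.single 0 1) ψ) s = pderiv x ψ s
    rw [pderiv_conv, pderiv_single, if_neg (Multiset.notMem_zero x), map_zero,
      LinearMap.zero_apply, zero_add, ih]

/-- The generating function `∑ₓ tₓ ψₓ`, in terms of multisets the sum of `ψₓ(s - x)` over the
entries `x` of `s`. -/
def removeSum : (α → Multiset α → R) →ₗ[R] (Multiset α → R) where
  toFun ψ s := (s.map fun x => ψ x (s.erase x)).sum
  map_add' _ _ := by ext; simp
  map_smul' _ _ := by ext; simp [Multiset.sum_map_mul_left]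

theorem removeSum_apply (ψ : α → Multiset α → R) (s : Multiset α) :
    removeSum ψ s = (s.map fun x => ψ x (s.erase x)).sum := rfl

@[simp] theorem removeSum_apply_zero (ψ : α → Multiset α → R) : removeSum ψ 0 = 0 := by
  simp [removeSum_apply]

theorem pderiv_removeSum (y : α) (ψ : α → Multiset α → R) :
    pderiv y (removeSum ψ) = ψ y + removeSum fun x => pderiv y (ψ x) := by
  ext s
  rw [pderiv_apply, removeSum_apply, Multiset.map_cons, Multiset.sum_cons,
    Multiset.erase_cons_head, Pi.add_apply, removeSum_apply]
  congr 2
  exact Multiset.map_congr rfl fun x hx => by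
    rw [pderiv_apply, Multiset.erase_cons_tail_of_mem hx]

theorem removeSum_apply_eq_zero {ψ : α → Multiset α → R} {s : Multiset α}
    (h : ∀ x ∈ s, ψ x (s.erase x) = 0) : removeSum ψ s = 0 := by
  rw [removeSum_apply, Multiset.map_congr rfl h, Multiset.sum_map_zero]

theorem conv_single (y : α) (ψ : Multiset α → R) :
    conv (Pi.single {y} 1) ψ = removeSum (Pi.single y ψ) := by
  ext s
  induction s using Multiset.induction generalizing ψ with
  | empty => simp
  | cons x s ih =>
    have hx : (fun z => pderiv x ((Pi.single y ψ : α → Multiset α → R) z)) =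
        Pi.single y (pderiv x ψ) :=
      funext fun z => Pi.apply_single (fun _ => pderiv x) (fun _ => map_zero _) y ψ z
    change pderiv x (conv (Pi.single {y} 1) ψ) s = pderiv x (removeSum (Pi.single y ψ)) s
    rw [pderiv_conv, pderiv_removeSum, Pi.add_apply, Pi.add_apply, ih, hx, pderiv_single]
    by_cases h : x = y
    · subst h; simp [conv_one]
    · simp [h]

end MultisetCalculus

/-! ### The string operator -/

section Raise

variable {M N : Type*} [AddCommMonoid M] [AddCommMonoid N]

/-- The index shift `f ↦ (2x+1) f_{x-1}`, with value `0` at `x = 0`. -/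
def raise (f : ℕ → M) : ℕ → M
  | 0 => 0
  | x + 1 => (2 * x + 3) • f x

@[simp] theorem raise_zero (f : ℕ → M) : raise f 0 = 0 := rfl

@[simp] theorem raise_succ (f : ℕ → M) (x : ℕ) : raise f (x + 1) = (2 * x + 3) • f x := rfl

theorem map_raise {F : Type*} [FunLike F M N] [AddMonoidHomClass F M N] (L : F) (f : ℕ → M)
    (x : ℕ) : L (raise f x) = raise (fun y => L (f y)) x := by
  cases x <;> simp

theorem raise_apply {ι : Type*} (f : ℕ → ι → M) (x : ℕ) (i : ι) :
    raise f x i = raise (fun y => f y i) x := by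
  cases x <;> rfl

theorem raise_add (f g : ℕ → M) (x : ℕ) :
    raise (fun y => f y + g y) x = raise f x + raise g x := by
  cases x <;> simp

theorem sum_raise {ι : Type*} (A : Finset ι) (f : ι → ℕ → M) (x : ℕ) :
    ∑ i ∈ A, raise (f i) x = raise (fun y => ∑ i ∈ A, f i y) x := by
  cases x <;> simp [Finset.smul_sum]

theorem sum_antidiagonal_raise (f : ℕ × ℕ → M) (k : ℕ) :
    ∑ p ∈ antidiagonal (k + 1),
        (raise (fun x => f (x, p.2)) p.1 + raise (fun y => f (p.1, y)) p.2) =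
      (2 * k + 6) • ∑ p ∈ antidiagonal k, f p := by
  rw [Finset.sum_add_distrib, Finset.Nat.sum_antidiagonal_succ, Finset.Nat.sum_antidiagonal_succ']
  simp only [raise_zero, raise_succ, zero_add]
  rw [← Finset.sum_add_distrib, Finset.smul_sum]
  refine Finset.sum_congr rfl fun p hp => ?_
  rw [← mem_antidiagonal.1 hp, ← add_smul]
  congr 1
  ring

end Raise

section StringOp

variable {R : Type*} [CommRing R]

theorem conv_raise_left {α : Type*} (f : ℕ → Multiset α → R) (ψ : Multiset α → R) (x : ℕ) :
    conv (raise f x) ψ = raise (fun y => conv (f y) ψ) x :=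
  map_raise (conv.flip ψ) f x

theorem removeSum_raise_apply {α : Type*} [DecidableEq α] (f : α → ℕ → Multiset α → R) (y : ℕ) :
    removeSum (fun x => raise (f x) y) = raise (fun z => removeSum fun x => f x z) y := by
  cases y with
  | zero => exact map_zero removeSum
  | succ y => exact map_nsmul removeSum (2 * y + 3) fun x => f x y

/-- The derivation `∑ₓ (2x+1) tₓ ∂/∂t_{x-1}`: it lowers one entry `x` of a multiset by one, with
weight `2x+1`. -/
def lowerSum : (Multiset ℕ → R) →ₗ[R] (Multiset ℕ → R) where
  toFun χ := removeSum (raise fun x => pderiv x χ)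
  map_add' χ ψ := by
    rw [← map_add]
    congr 1
    ext1 x
    simp only [map_add, raise_add, Pi.add_apply]
  map_smul' c χ := by
    rw [← map_smul]
    congr 1
    ext1 x
    cases x <;> simp

theorem lowerSum_def (χ : Multiset ℕ → R) : lowerSum χ = removeSum (raise fun x => pderiv x χ) :=
  rfl

@[simp] theorem lowerSum_apply_zero (χ : Multiset ℕ → R) : lowerSum χ 0 = 0 := by
  rw [lowerSum_def, removeSum_apply_zero]

theorem pderiv_lowerSum (y : ℕ) (χ : Multiset ℕ → R) :
    pderiv y (lowerSum χ) = raise (fun x => pderiv x χ) y + lowerSum (pderiv y χ) := by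
  simp only [lowerSum_def, pderiv_removeSum, map_raise, pderiv_comm y]

theorem lowerSum_conv (χ ψ : Multiset ℕ → R) :
    lowerSum (conv χ ψ) = conv (lowerSum χ) ψ + conv χ (lowerSum ψ) := by
  ext s
  induction s using Multiset.induction generalizing χ ψ with
  | empty => simp
  | cons y s ih =>
    change pderiv y (lowerSum (conv χ ψ)) s = pderiv y (conv (lowerSum χ) ψ + conv χ (lowerSum ψ)) s
    simp only [map_add, pderiv_lowerSum, pderiv_conv, conv_raise_left, raise_add,
      LinearMap.add_apply, Pi.add_apply, ih]
    rw [map_raise (conv χ)]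
    ring

theorem lowerSum_removeSum (ψ : ℕ → Multiset ℕ → R) :
    lowerSum (removeSum ψ) = removeSum (fun x => lowerSum (ψ x)) + removeSum (raise ψ) := by
  ext s
  induction s using Multiset.induction generalizing ψ with
  | empty => simp
  | cons y s ih =>
    have hlower : (fun x => pderiv y (lowerSum (ψ x))) =
        (fun x => raise (fun z => pderiv z (ψ x)) y) + fun x => lowerSum (pderiv y (ψ x)) :=
      funext fun x => pderiv_lowerSum y (ψ x)
    change pderiv y (lowerSum (removeSum ψ)) s =
      pderiv y (removeSum (fun x => lowerSum (ψ x)) + removeSum (raise ψ)) s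
    rw [pderiv_lowerSum, map_add, pderiv_removeSum, pderiv_removeSum, pderiv_removeSum, hlower]
    simp only [map_add, pderiv_removeSum, removeSum_raise_apply, raise_add, map_raise, Pi.add_apply,
      ih]
    ring

/-- The string operator `∂/∂t₀ - a ∂/∂t₁ - ∑ₓ (2x+1) tₓ ∂/∂t_{x-1}`, in which the time `t₁` is
shifted by the parameter `a`. -/
def stringOp (a : R) : (Multiset ℕ → R) →ₗ[R] (Multiset ℕ → R) :=
  pderiv 0 - a • pderiv 1 - lowerSum

theorem stringOp_def (a : R) (χ : Multiset ℕ → R) :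
    stringOp a χ = pderiv 0 χ - a • pderiv 1 χ - lowerSum χ := rfl

theorem stringOp_conv (a : R) (χ ψ : Multiset ℕ → R) :
    stringOp a (conv χ ψ) = conv (stringOp a χ) ψ + conv χ (stringOp a ψ) := by
  simp only [stringOp_def, pderiv_conv, lowerSum_conv, map_sub, map_smul, LinearMap.sub_apply,
    LinearMap.smul_apply, smul_add]
  abel

theorem pderiv_stringOp (a : R) (y : ℕ) (χ : Multiset ℕ → R) :
    pderiv y (stringOp a χ) = stringOp a (pderiv y χ) - raise (fun x => pderiv x χ) y := by
  simp only [stringOp_def, map_sub, map_smul, pderiv_lowerSum, pderiv_comm y]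
  abel

theorem stringOp_removeSum (a : R) (ψ : ℕ → Multiset ℕ → R) :
    stringOp a (removeSum ψ) =
      ψ 0 - a • ψ 1 + removeSum (fun x => stringOp a (ψ x)) - removeSum (raise ψ) := by
  have hstring : (fun x => stringOp a (ψ x)) = (fun x => pderiv 0 (ψ x)) -
      a • (fun x => pderiv 1 (ψ x)) - fun x => lowerSum (ψ x) := rfl
  rw [hstring, map_sub, map_sub, map_smul, stringOp_def, lowerSum_removeSum, pderiv_removeSum,
    pderiv_removeSum, smul_add]
  abel

end StringOp

/-! ### The Virasoro recursion and the string equation -/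

section Virasoro

variable {K : Type*} [Field K]

/-- The initial values of the Virasoro recursion: `F_{0;0,0,0} = 1` and `F_{1;1} = 1/8`. -/
def virInit (g k : ℕ) : Multiset ℕ → K :=
  (if g = 0 ∧ k = 0 then Pi.single {0, 0} 1 else 0) +
    if g = 1 ∧ k = 1 then Pi.single 0 (1 / 8) else 0

/-- The contribution `(2x+1) w_{k+x-1}` of merging the head index `k` with an entry `x`. -/
def virMerge (w : ℕ → Multiset ℕ → K) (k x : ℕ) : Multiset ℕ → K :=
  if k + x = 0 then 0 else (2 * x + 1) • w (k + x - 1)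

/-- The contribution of lowering the genus by one, with new indices `p`. -/
def virLoop (v : ℕ → ℕ → Multiset ℕ → K) : ℕ → ℕ × ℕ → Multiset ℕ → K
  | 0, _ => 0
  | g + 1, p => pderiv p.2 (v g p.1)

/-- The contribution of splitting the genus and the entries into two parts, with new indices `p`.
The two factors may come from different families, so that the expression can be polarised. -/
def virSplit (v w : ℕ → ℕ → Multiset ℕ → K) (g : ℕ) (p : ℕ × ℕ) : Multiset ℕ → K :=
  ∑ h ∈ antidiagonal g, conv (v h.1 p.1) (w h.2 p.2)

/-- The quadratic part of the Virasoro recursion, which changes the topological type. -/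
def virQuad (v : ℕ → ℕ → Multiset ℕ → K) (g : ℕ) : ℕ → Multiset ℕ → K
  | k + 2 => (1 / 2 : K) • ∑ p ∈ antidiagonal k, (virLoop v g p + virSplit v v g p)
  | _ => 0

/-- Amplitudes `v g k s` of genus `g` with a distinguished index `k` and further indices `s` that
satisfy the Virasoro constraints of the Witten–Kontsevich partition function with the time `t₁`
shifted by `a`. -/
structure IsVirasoro (a : K) (v : ℕ → ℕ → Multiset ℕ → K) : Prop where
  vanish : ∀ g k s, 3 * g + s.card < k + s.sum + 2 → v g k s = 0
  rec_eq : ∀ g k, v g k =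
    a • v g (k + 1) + removeSum (virMerge (v g) k) + virQuad v g k + virInit g k

theorem virInit_add_two (g k : ℕ) : virInit g (k + 2) = (0 : Multiset ℕ → K) := by
  simp [virInit]

theorem pderiv_virInit_zero (g k : ℕ) :
    pderiv k (virInit g 0) = (if g = 0 ∧ k = 0 then Pi.single {0} 1 else 0 : Multiset ℕ → K) := by
  by_cases hg : g = 0
  · by_cases hk : k = 0 <;> simp [virInit, hg, hk, pderiv_single]
  · simp [virInit, hg]

theorem pderiv_pderiv_virInit_zero (g : ℕ) (p : ℕ × ℕ) : pderiv p.2 (pderiv p.1 (virInit g 0)) =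
    (if g = 0 ∧ p = (0, 0) then Pi.single 0 1 else 0 : Multiset ℕ → K) := by
  obtain ⟨i, j⟩ := p
  by_cases hi : g = 0 ∧ i = 0
  · by_cases hj : j = 0 <;> simp [pderiv_virInit_zero, hi, hj, pderiv_single]
  · rw [pderiv_virInit_zero, if_neg hi, map_zero, if_neg fun h => hi ⟨h.1, (Prod.ext_iff.1 h.2).1⟩]

theorem stringOp_virInit_succ (a : K) (g k : ℕ) : stringOp a (virInit g (k + 1)) = 0 := by
  have hpderiv : ∀ x, pderiv x (virInit g (k + 1) : Multiset ℕ → K) = 0 := fun x => by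
    by_cases h : g = 1 ∧ k = 0 <;> simp [virInit, h, pderiv_single]
  have hraise : (raise fun _ => (0 : Multiset ℕ → K)) = 0 := by
    ext1 x
    cases x <;> simp
  simp only [stringOp_def, lowerSum_def, hpderiv, hraise, map_zero, smul_zero, sub_zero]

/-- Euler's identity for the quadratic monomial `t₀² / 2`. -/
theorem removeSum_smul_pderiv_virInit_zero (g : ℕ) :
    removeSum (fun x => (2 * x + 1) • pderiv x (virInit g 0)) =
      (2 : K) • (virInit g 0 : Multiset ℕ → K) := by
  simp only [pderiv_virInit_zero]
  by_cases hg : g = 0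
  · have hfun : (fun x => (2 * x + 1) •
        (if g = 0 ∧ x = 0 then Pi.single {0} 1 else 0 : Multiset ℕ → K)) =
        Pi.single 0 (Pi.single {0} 1) := by
      ext1 x
      cases x <;> simp [hg]
    rw [hfun]
    ext s
    by_cases hs : s = {0, 0}
    · simp [hs, hg, virInit, removeSum_apply, one_add_one_eq_two]
    · have hzero : removeSum (Pi.single 0 (Pi.single {0} 1) : ℕ → Multiset ℕ → K) s = 0 := by
        refine removeSum_apply_eq_zero fun x hx => ?_
        by_cases hx0 : x = 0
        · subst hx0
          rw [Pi.single_eq_same, Pi.single_eq_of_ne fun h => hs ?_]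
          rw [← Multiset.cons_erase hx, h]
          rfl
        · rw [Pi.single_eq_of_ne hx0, Pi.zero_apply]
      rw [hzero]
      simp [virInit, hg, show s ≠ 0 ::ₘ {0} from hs]
  · simp [virInit, hg, ← Pi.zero_def]

theorem virMerge_add (w w' : ℕ → Multiset ℕ → K) (k : ℕ) :
    virMerge (w + w') k = virMerge w k + virMerge w' k := by
  ext1 x
  simp only [virMerge, Pi.add_apply]
  split_ifs <;> simp only [smul_add, add_zero]

theorem virMerge_zero (w : ℕ → Multiset ℕ → K) : virMerge w 0 = raise w := by
  ext1 x
  cases x with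
  | zero => simp [virMerge]
  | succ x => simp [virMerge, mul_add, add_assoc]

theorem virMerge_succ (w : ℕ → Multiset ℕ → K) (k x : ℕ) :
    virMerge w (k + 1) x = (2 * x + 1) • w (k + x) := by
  rw [virMerge, if_neg (by omega), show k + 1 + x - 1 = k + x by omega]

theorem stringOp_virMerge (a : K) (w : ℕ → Multiset ℕ → K) (k x : ℕ) :
    stringOp a (virMerge w k x) = virMerge (fun i => stringOp a (w i)) k x := by
  simp only [virMerge]
  split_ifs <;> simp only [map_zero, map_nsmul]

theorem virSplit_add_left (v v' w : ℕ → ℕ → Multiset ℕ → K) (g : ℕ) (p : ℕ × ℕ) :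
    virSplit (v + v') w g p = virSplit v w g p + virSplit v' w g p := by
  simp only [virSplit, Pi.add_apply, map_add, LinearMap.add_apply, Finset.sum_add_distrib]

theorem virSplit_add_right (v w w' : ℕ → ℕ → Multiset ℕ → K) (g : ℕ) (p : ℕ × ℕ) :
    virSplit v (w + w') g p = virSplit v w g p + virSplit v w' g p := by
  simp only [virSplit, Pi.add_apply, map_add, Finset.sum_add_distrib]

theorem virSplit_swap (v w : ℕ → ℕ → Multiset ℕ → K) (g : ℕ) (p : ℕ × ℕ) :
    virSplit v w g p.swap = virSplit w v g p := by
  simp only [virSplit, conv_comm (v _ _)]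
  exact Finset.Nat.sum_antidiagonal_swap (f := fun h => conv (w h.1 p.1) (v h.2 p.2))

theorem stringOp_virSplit (a : K) (v w : ℕ → ℕ → Multiset ℕ → K) (g : ℕ) (p : ℕ × ℕ) :
    stringOp a (virSplit v w g p) = virSplit (fun h i => stringOp a (v h i)) w g p +
      virSplit v (fun h i => stringOp a (w h i)) g p := by
  simp only [virSplit, map_sum, stringOp_conv, Finset.sum_add_distrib]

/-- The right-hand side of the string equation for the amplitudes of genus `g` with head `k`. -/
def stringSource (v : ℕ → ℕ → Multiset ℕ → K) (g k : ℕ) : Multiset ℕ → K :=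
  raise (v g) k + pderiv k (virInit g 0)

theorem stringSource_succ (v : ℕ → ℕ → Multiset ℕ → K) (g k : ℕ) :
    stringSource v g (k + 1) = (2 * k + 3) • v g k := by
  simp [stringSource, pderiv_virInit_zero]

/-- The defect of the string equation. -/
def stringDefect (a : K) (v : ℕ → ℕ → Multiset ℕ → K) (g k : ℕ) : Multiset ℕ → K :=
  stringOp a (v g k) - stringSource v g k

theorem stringOp_eq_defect_add_source (a : K) (v : ℕ → ℕ → Multiset ℕ → K) :
    (fun g k => stringOp a (v g k)) = stringDefect a v + stringSource v := by
  ext1 g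
  ext1 k
  exact (sub_add_cancel _ _).symm

theorem stringOp_virLoop (a : K) (v : ℕ → ℕ → Multiset ℕ → K) (g : ℕ) (p : ℕ × ℕ) :
    stringOp a (virLoop v g p) = virLoop (stringDefect a v) g p +
      (raise (fun x => virLoop v g (x, p.2)) p.1 + raise (fun y => virLoop v g (p.1, y)) p.2) +
      if g = 1 ∧ p = (0, 0) then Pi.single 0 1 else 0 := by
  obtain ⟨i, j⟩ := p
  cases g with
  | zero => cases i <;> cases j <;> simp [virLoop]
  | succ g =>
    have hinit := pderiv_pderiv_virInit_zero (K := K) g (i, j)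
    have hcomm := pderiv_stringOp a j (v g i)
    simp only [virLoop, stringDefect, stringSource, map_sub, map_add, map_raise, Nat.succ_inj]
      at hinit hcomm ⊢
    rw [hcomm, hinit]
    abel

theorem virSplit_stringSource_left (v w : ℕ → ℕ → Multiset ℕ → K) (g : ℕ) (p : ℕ × ℕ) :
    virSplit (stringSource v) w g p = raise (fun x => virSplit v w g (x, p.2)) p.1 +
      if p.1 = 0 then removeSum (Pi.single 0 (w g p.2)) else 0 := by
  simp only [virSplit, stringSource, map_add, LinearMap.add_apply, conv_raise_left,
    Finset.sum_add_distrib, sum_raise, pderiv_virInit_zero]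
  congr 1
  rw [Finset.sum_eq_single (0, g)]
  · split_ifs <;> simp_all [conv_single]
  · intro h hh hne
    have h0 : h.1 ≠ 0 := fun h0 => hne (Prod.ext h0 (by have := mem_antidiagonal.1 hh; simp; omega))
    simp [h0]
  · simp

theorem virSplit_stringSource_right (v w : ℕ → ℕ → Multiset ℕ → K) (g : ℕ) (p : ℕ × ℕ) :
    virSplit v (stringSource w) g p = raise (fun y => virSplit v w g (p.1, y)) p.2 +
      if p.2 = 0 then removeSum (Pi.single 0 (v g p.1)) else 0 := by
  rw [← virSplit_swap, virSplit_stringSource_left]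
  simp only [← virSplit_swap w v, Prod.swap]

/-- The derivative of `virQuad` at `v` in the direction `d`. -/
def virQuadDeriv (v d : ℕ → ℕ → Multiset ℕ → K) (g : ℕ) : ℕ → Multiset ℕ → K
  | k + 2 => (1 / 2 : K) •
      ∑ p ∈ antidiagonal k, (virLoop d g p + virSplit d v g p + virSplit v d g p)
  | _ => 0

theorem stringOp_removeSum_virMerge (a : K) (v : ℕ → ℕ → Multiset ℕ → K) (g k : ℕ) :
    stringOp a (removeSum (virMerge (v g) k)) =
      virMerge (v g) k 0 - a • virMerge (v g) k 1 + removeSum (virMerge (stringDefect a v g) k) +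
        (removeSum (virMerge (stringSource v g) k) - removeSum (raise (virMerge (v g) k))) := by
  have hsplit : (fun x => stringOp a (virMerge (v g) k x)) =
      virMerge (stringDefect a v g) k + virMerge (stringSource v g) k := by
    rw [← virMerge_add]
    ext1 x
    rw [stringOp_virMerge]
    exact congrArg (virMerge · k x) (congrFun (stringOp_eq_defect_add_source a v) g)
  rw [stringOp_removeSum, hsplit, map_add]
  abel

theorem removeSum_virMerge_stringSource_zero (v : ℕ → ℕ → Multiset ℕ → K) (g : ℕ) :
    removeSum (virMerge (stringSource v g) 0) - removeSum (raise (virMerge (v g) 0)) =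
      lowerSum (virInit g 0) := by
  rw [lowerSum_def, ← map_sub]
  congr 1
  ext1 x
  cases x with
  | zero => simp [virMerge_zero]
  | succ x => simp [virMerge_zero, stringSource]

theorem removeSum_virMerge_stringSource_one (v : ℕ → ℕ → Multiset ℕ → K) (g : ℕ) :
    removeSum (virMerge (stringSource v g) 1) - removeSum (raise (virMerge (v g) 1)) =
      2 • (removeSum (virMerge (v g) 0) + virInit g 0) := by
  have hmerge : virMerge (stringSource v g) 1 - raise (virMerge (v g) 1) =
      2 • virMerge (v g) 0 + fun x => (2 * x + 1) • pderiv x (virInit g 0) := by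
    ext1 x
    cases x with
    | zero => simp [virMerge_succ, virMerge_zero, stringSource]
    | succ x =>
      simp only [virMerge_succ, virMerge_zero, stringSource, Pi.sub_apply, Pi.add_apply,
        Pi.smul_apply, raise_succ, zero_add]
      module
  rw [← map_sub, hmerge, map_add, removeSum_smul_pderiv_virInit_zero, map_nsmul, smul_add,
    ofNat_smul_eq_nsmul K]

theorem removeSum_virMerge_stringSource_add_two (v : ℕ → ℕ → Multiset ℕ → K) (g k : ℕ) :
    removeSum (virMerge (stringSource v g) (k + 2)) - removeSum (raise (virMerge (v g) (k + 2))) =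
      (2 * k + 4) • removeSum (virMerge (v g) (k + 1)) - removeSum (Pi.single 0 (v g k)) := by
  have hmerge : virMerge (stringSource v g) (k + 2) - raise (virMerge (v g) (k + 2)) =
      (2 * k + 4) • virMerge (v g) (k + 1) - Pi.single 0 (v g k) := by
    ext1 x
    cases x with
    | zero =>
      simp only [virMerge_succ, stringSource, pderiv_virInit_zero, Pi.sub_apply, Pi.smul_apply,
        raise_zero, raise_succ, Pi.single_eq_same, add_zero, Nat.add_eq_zero_iff, one_ne_zero,
        and_false, if_false]
      module
    | succ x =>
      have hne : x + 1 ≠ 0 := x.succ_ne_zero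
      simp only [virMerge_succ, stringSource, pderiv_virInit_zero, Pi.sub_apply, Pi.smul_apply,
        raise_succ, Pi.single_eq_of_ne hne, ← add_assoc, Nat.add_eq_zero_iff, one_ne_zero,
        and_false, if_false]
      rw [show k + x + 1 = k + 1 + x by ring]
      module
  rw [← map_sub, hmerge, map_sub, map_nsmul]

theorem stringDefect_eq_zero_of_lt {a : K} {v : ℕ → ℕ → Multiset ℕ → K} (hv : IsVirasoro a v)
    {g k : ℕ} {s : Multiset ℕ} (hk : 3 * g + s.card < k) : stringDefect a v g k s = 0 := by
  obtain ⟨j, rfl⟩ : ∃ j, k = j + 1 := ⟨k - 1, by omega⟩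
  have hcons : ∀ x, v g (j + 1) (x ::ₘ s) = 0 := fun x =>
    hv.vanish _ _ _ (by simp only [Multiset.card_cons, Multiset.sum_cons]; omega)
  have hlower : lowerSum (v g (j + 1)) s = 0 := by
    rw [lowerSum_def]
    refine removeSum_apply_eq_zero ?_
    rintro (- | x) hx
    · rfl
    · rw [raise_succ, Pi.smul_apply, pderiv_apply, hv.vanish, smul_zero]
      have hcard := Multiset.card_erase_add_one hx
      simp only [Multiset.card_cons, Multiset.sum_cons]
      omega
  have hsource : v g j s = 0 := hv.vanish _ _ _ (by omega)
  simp [stringDefect, stringSource_succ, stringOp_def, hcons, hlower, hsource]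

theorem virSplit_apply_eq_zero {v d : ℕ → ℕ → Multiset ℕ → K} {g : ℕ} {s : Multiset ℕ}
    (hd : ∀ h k t, 2 * h + t.card < 2 * g + s.card → d h k t = 0) (hv : ∀ k, v 0 k 0 = 0)
    (p : ℕ × ℕ) : virSplit d v g p s = 0 := by
  rw [virSplit, Finset.sum_apply]
  refine Finset.sum_eq_zero fun h hh => conv_apply_eq_zero fun t₁ t₂ ht => ?_
  have hgenus := mem_antidiagonal.1 hh
  have hcard : t₁.card + t₂.card = s.card := by
    rw [← Multiset.card_add, ht]
  by_cases hlt : 2 * h.1 + t₁.card < 2 * g + s.card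
  · rw [hd _ _ _ hlt, zero_mul]
  · rw [show h.2 = 0 by omega, Multiset.card_eq_zero.1 (show t₂.card = 0 by omega), hv, mul_zero]

theorem virQuadDeriv_apply_eq_zero {v d : ℕ → ℕ → Multiset ℕ → K} {g : ℕ} {s : Multiset ℕ}
    (hd : ∀ h k t, 2 * h + t.card < 2 * g + s.card → d h k t = 0) (hv : ∀ k, v 0 k 0 = 0)
    (k : ℕ) : virQuadDeriv v d g k s = 0 := by
  have hloop : ∀ p, virLoop d g p s = 0 := fun p => by
    cases g with
    | zero => rfl
    | succ g => exact hd _ _ _ (by rw [Multiset.card_cons]; omega)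
  match k with
  | 0 => rfl
  | 1 => rfl
  | k + 2 =>
    rw [virQuadDeriv, Pi.smul_apply, Finset.sum_apply, Finset.sum_eq_zero, smul_zero]
    intro p _
    rw [Pi.add_apply, Pi.add_apply, hloop, ← virSplit_swap d v, virSplit_apply_eq_zero hd hv,
      virSplit_apply_eq_zero hd hv, add_zero, add_zero]

variable [CharZero K]

theorem sum_antidiagonal_raise_virQuad (v : ℕ → ℕ → Multiset ℕ → K) (g k : ℕ) :
    ∑ p ∈ antidiagonal k,
        (raise (fun x => virLoop v g (x, p.2) + virSplit v v g (x, p.2)) p.1 +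
          raise (fun y => virLoop v g (p.1, y) + virSplit v v g (p.1, y)) p.2) =
      (2 : K) • (2 * k + 4) • virQuad v g (k + 1) := by
  cases k with
  | zero => simp [virQuad]
  | succ k =>
    rw [sum_antidiagonal_raise fun p => virLoop v g p + virSplit v v g p, virQuad, smul_comm,
      smul_smul, mul_one_div_cancel two_ne_zero, one_smul, mul_add, add_assoc]

theorem sum_antidiagonal_ite_eq_smul_virInit (g k : ℕ) :
    ∑ p ∈ antidiagonal k,
        (if g = 1 ∧ p = (0, 0) then Pi.single 0 1 else 0 : Multiset ℕ → K) =
      (2 : K) • (2 * k + 4) • virInit g (k + 1) := by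
  cases k with
  | zero =>
    by_cases hg : g = 1
    · ext s
      simp [virInit, hg, Pi.single_apply]
      norm_num
    · simp [virInit, hg]
  | succ k =>
    rw [virInit_add_two, smul_zero, smul_zero]
    refine Finset.sum_eq_zero fun p hp => if_neg ?_
    rintro ⟨-, rfl⟩
    simp at hp

theorem stringOp_virQuad_add_two (a : K) (v : ℕ → ℕ → Multiset ℕ → K) (g k : ℕ) :
    stringOp a (virQuad v g (k + 2)) = virQuadDeriv v (stringDefect a v) g (k + 2) +
      (2 * k + 4) • (virQuad v g (k + 1) + virInit g (k + 1)) +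
      removeSum (Pi.single 0 (v g k)) := by
  have hleft : ∑ p ∈ antidiagonal k, (if p.1 = 0 then removeSum (Pi.single 0 (v g p.2)) else 0) =
      removeSum (Pi.single 0 (v g k)) := by
    rw [Finset.sum_eq_single (0, k)]
    · simp
    · exact fun p hp hne => if_neg fun h0 => hne (Prod.ext h0 (by simp_all))
    · simp
  have hright : ∑ p ∈ antidiagonal k, (if p.2 = 0 then removeSum (Pi.single 0 (v g p.1)) else 0) =
      removeSum (Pi.single 0 (v g k)) := by
    rw [← hleft]
    exact Finset.Nat.sum_antidiagonal_swap
      (f := fun p => if p.1 = 0 then removeSum (Pi.single 0 (v g p.2)) else 0)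
  have hsum : ∑ p ∈ antidiagonal k, stringOp a (virLoop v g p + virSplit v v g p) =
      ∑ p ∈ antidiagonal k, (virLoop (stringDefect a v) g p + virSplit (stringDefect a v) v g p +
        virSplit v (stringDefect a v) g p) +
      (2 : K) • ((2 * k + 4) • (virQuad v g (k + 1) + virInit g (k + 1)) +
        removeSum (Pi.single 0 (v g k))) := by
    have hquad := sum_antidiagonal_raise_virQuad v g k
    simp only [raise_add, Finset.sum_add_distrib] at hquad
    simp only [map_add, stringOp_virLoop, stringOp_virSplit, stringOp_eq_defect_add_source,
      virSplit_add_left, virSplit_add_right, virSplit_stringSource_left,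
      virSplit_stringSource_right, Finset.sum_add_distrib, sum_antidiagonal_ite_eq_smul_virInit,
      hleft, hright, smul_add, two_smul K (removeSum _), ← hquad]
    abel
  rw [virQuad, map_smul, map_sum, hsum, smul_add, smul_smul, one_div_mul_cancel two_ne_zero,
    one_smul, virQuadDeriv, add_assoc]

theorem stringDefect_rec {a : K} {v : ℕ → ℕ → Multiset ℕ → K} (hv : IsVirasoro a v) (g k : ℕ) :
    stringDefect a v g k = a • stringDefect a v g (k + 1) +
      removeSum (virMerge (stringDefect a v g) k) + virQuadDeriv v (stringDefect a v) g k := by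
  have hsource : stringOp a (v g (k + 1)) = stringDefect a v g (k + 1) + stringSource v g (k + 1) :=
    (sub_add_cancel _ _).symm
  have hrec := congrArg (stringOp a) (hv.rec_eq g k)
  rw [map_add, map_add, map_add, map_smul, hsource, stringOp_removeSum_virMerge] at hrec
  rw [stringDefect, hrec]
  rcases k with - | - | k
  · have hinit : stringOp a (virInit g 0) = stringSource v g 0 - lowerSum (virInit g 0) := by
      simp [stringOp_def, stringSource, pderiv_virInit_zero]
    rw [removeSum_virMerge_stringSource_zero, hinit]
    simp only [virQuad, virQuadDeriv, map_zero,
      virMerge_zero, raise_zero, raise_succ, stringSource_succ]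
    module
  · rw [removeSum_virMerge_stringSource_one, stringOp_virInit_succ]
    have hv0 := hv.rec_eq g 0
    simp only [stringSource_succ, virQuad, virQuadDeriv, map_zero, virMerge_succ, zero_add]
      at hv0 ⊢
    linear_combination (norm := module) -(2 : K) • hv0
  · rw [stringOp_virInit_succ, stringOp_virQuad_add_two, removeSum_virMerge_stringSource_add_two]
    simp only [stringSource_succ, virMerge_succ, add_zero]
    linear_combination (norm := module) -(2 * k + 4 : K) • hv.rec_eq g (k + 1)

theorem IsVirasoro.stringOp_eq {a : K} {v : ℕ → ℕ → Multiset ℕ → K} (hv : IsVirasoro a v)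
    (g k : ℕ) : stringOp a (v g k) = stringSource v g k := by
  suffices hdefect : ∀ n g k s, 2 * g + s.card = n → stringDefect a v g k s = 0 from
    funext fun s => sub_eq_zero.1 (hdefect _ g k s rfl)
  intro n
  induction n using Nat.strong_induction_on with
  | _ n ih =>
    rintro g k s rfl
    have hsmaller : ∀ h k t, 2 * h + t.card < 2 * g + s.card → stringDefect a v h k t = 0 :=
      fun h k t hlt => ih _ hlt h k t rfl
    have hmerge : ∀ k, removeSum (virMerge (stringDefect a v g) k) s = 0 := fun k => by
      refine removeSum_apply_eq_zero fun x hx => ?_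
      have hcard := Multiset.card_erase_add_one hx
      unfold virMerge
      split_ifs
      · rfl
      · rw [Pi.smul_apply, hsmaller _ _ _ (by omega), smul_zero]
    have hquad := virQuadDeriv_apply_eq_zero hsmaller fun k => hv.vanish 0 k 0 (by simp)
    have hstep : ∀ k, stringDefect a v g k s = a * stringDefect a v g (k + 1) s := fun k => by
      rw [stringDefect_rec hv]
      simp only [Pi.add_apply, hmerge, hquad, add_zero, Pi.smul_apply, smul_eq_mul]
    have hiterate (j : ℕ) : stringDefect a v g k s = a ^ j * stringDefect a v g (k + j) s := by
      induction j with
      | zero => simp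
      | succ j hj => rw [hj, hstep (k + j), pow_succ, mul_assoc, add_assoc]
    rw [hiterate (3 * g + s.card + 1), stringDefect_eq_zero_of_lt hv (by omega), mul_zero]

end Virasoro

/-! ### Sums of factorials -/

section Factorials

theorem sum_antidiagonal_choose_mul_choose (a b n : ℕ) :
    ∑ p ∈ antidiagonal n, (a + p.1).choose a * (b + p.2).choose b =
      (a + b + 1 + n).choose (a + b + 1) := by
  have hmul := congrArg Units.val (PowerSeries.invOneSubPow_add ℤ (a + 1) (b + 1))
  rw [Units.val_mul, show a + 1 + (b + 1) = a + b + 1 + 1 by ring,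
    PowerSeries.invOneSubPow_val_succ_eq_mk_add_choose,
    PowerSeries.invOneSubPow_val_succ_eq_mk_add_choose,
    PowerSeries.invOneSubPow_val_succ_eq_mk_add_choose] at hmul
  have hcoeff := congrArg (PowerSeries.coeff n) hmul
  simp only [PowerSeries.coeff_mul, PowerSeries.coeff_mk] at hcoeff
  exact_mod_cast hcoeff.symm

theorem factorial_add_div_factorial (a n : ℕ) :
    ((a + n)! : ℝ) / n ! = a ! * (a + n).choose a := by
  rw [div_eq_iff (by positivity), ← Nat.add_choose_mul_factorial_mul_factorial]
  push_cast
  rw [Nat.choose_symm_add]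
  ring

theorem sum_antidiagonal_factorial_div (a b n : ℕ) :
    ∑ p ∈ antidiagonal n, ((a + p.1)! / p.1 ! : ℝ) * ((b + p.2)! / p.2 !) =
      a ! * b ! / (a + b + 1)! * ((a + b + 1 + n)! / n !) := by
  simp only [factorial_add_div_factorial, ← sum_antidiagonal_choose_mul_choose]
  push_cast
  rw [← mul_assoc, div_mul_cancel₀ _ (by positivity), Finset.mul_sum]
  exact Finset.sum_congr rfl fun p _ => by ring

theorem sum_map_antidiagonal_factorial_div {α : Type*} (s : Multiset α) (a b n : ℕ) :
    (s.antidiagonal.map fun t => ∑ p ∈ antidiagonal n,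
      ((a + t.1.card + p.1)! / p.1 ! : ℝ) * ((b + t.2.card + p.2)! / p.2 !)).sum =
      a ! * b ! / (a + b + 1)! * ((a + b + 1 + s.card + n)! / n !) := by
  induction s using Multiset.induction generalizing a b with
  | empty => simp [sum_antidiagonal_factorial_div]
  | cons y s ih =>
    have hright := ih a (b + 1)
    have hleft := ih (a + 1) b
    simp only [← add_assoc, add_right_comm _ 1] at hleft hright
    simp only [Multiset.antidiagonal_cons, Multiset.map_add, Multiset.sum_add, Multiset.map_map,
      Function.comp_apply, Prod.map_fst, Prod.map_snd, id_eq, Multiset.card_cons, ← add_assoc,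
      add_right_comm _ 1]
    rw [hleft, hright, Nat.factorial_succ (a + b + 1), Nat.factorial_succ a, Nat.factorial_succ b]
    push_cast
    field_simp
    ring

end Factorials

/-! ### The genus dependence of the bounds -/

section GenusWeight

/-- The weight `(j+2)(j+1)²(2j)!` of genus `j + 1` in the splitting of the genus. -/
def genusWeight (j : ℕ) : ℝ := (j + 2) * (j + 1) ^ 2 * (2 * j)!

/-- The ratio of consecutive weights `genusWeight`. -/
def genusRatio (j : ℕ) : ℝ := 2 * (j + 3) * (j + 2) * (2 - 1 / (j + 1))

theorem genusWeight_pos (j : ℕ) : 0 < genusWeight j := by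
  unfold genusWeight
  positivity

theorem genusWeight_zero : genusWeight 0 = 2 := by norm_num [genusWeight]

theorem genusWeight_one : genusWeight 1 = 24 := by norm_num [genusWeight, Nat.factorial]

theorem genusWeight_succ (j : ℕ) : genusWeight (j + 1) = genusRatio j * genusWeight j := by
  rw [genusWeight, genusWeight, genusRatio, mul_add_one, Nat.factorial_succ, Nat.factorial_succ]
  push_cast
  field_simp
  ring

theorem one_le_two_sub_one_div (j : ℕ) : (1 : ℝ) ≤ 2 - 1 / (j + 1) := by
  have hdiv : (1 : ℝ) / (j + 1) ≤ 1 := div_le_one_of_le₀ (by simp) (by positivity)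
  linarith

theorem le_genusRatio (j : ℕ) : 2 * (j + 3) * (j + 2) ≤ genusRatio j :=
  le_mul_of_one_le_right (by positivity) (one_le_two_sub_one_div j)

theorem monotone_genusRatio : Monotone genusRatio := by
  intro i j hij
  have := one_le_two_sub_one_div i
  unfold genusRatio
  gcongr

theorem genusWeight_mul_le (i j : ℕ) :
    genusWeight (i + 1) * genusWeight (j + 1) ≤ 24 * genusWeight (i + j + 1) := by
  induction i with
  | zero => rw [zero_add, zero_add, genusWeight_one]
  | succ i ih =>
    have hratio := monotone_genusRatio (show i + 1 ≤ i + j + 1 by omega)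
    have := genusWeight_pos (i + j + 1)
    rw [show i + 1 + j + 1 = i + j + 1 + 1 by ring, genusWeight_succ (i + 1),
      genusWeight_succ (i + j + 1)]
    calc genusRatio (i + 1) * genusWeight (i + 1) * genusWeight (j + 1)
        = genusRatio (i + 1) * (genusWeight (i + 1) * genusWeight (j + 1)) := mul_assoc _ _ _
      _ ≤ genusRatio (i + j + 1) * (24 * genusWeight (i + j + 1)) := by
        have := genusWeight_pos (i + 1)
        have := genusWeight_pos (j + 1)
        have : 0 ≤ genusRatio (i + j + 1) := le_trans (by positivity) (le_genusRatio (i + j + 1))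
        gcongr
      _ = 24 * (genusRatio (i + j + 1) * genusWeight (i + j + 1)) := mul_left_comm _ _ _

theorem genusWeight_le (m : ℕ) : genusWeight m ≤ (m + 2) ^ 2 * (2 * m + 1)! := by
  have hpoly : (m + 2 : ℝ) * (m + 1) ^ 2 ≤ (m + 2) ^ 2 * (2 * m + 1) := by
    nlinarith [Nat.cast_nonneg (α := ℝ) m, sq_nonneg (m : ℝ)]
  rw [genusWeight, Nat.factorial_succ, Nat.cast_mul, ← mul_assoc]
  push_cast
  gcongr

theorem mul_genusWeight_succ_le (m : ℕ) :
    (m + 1) * (24 * genusWeight (m + 1)) ≤ 20 * genusWeight (m + 2) := by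
  have hratio : (m + 1) * 24 ≤ 20 * genusRatio (m + 1) := by
    have := le_genusRatio (m + 1)
    push_cast at this
    nlinarith [Nat.cast_nonneg (α := ℝ) m]
  rw [genusWeight_succ (m + 1), ← mul_assoc, ← mul_assoc]
  exact mul_le_mul_of_nonneg_right hratio (genusWeight_pos (m + 1)).le

theorem sum_genusWeight_le (m : ℕ) :
    ∑ p ∈ antidiagonal m, genusWeight p.1 * genusWeight p.2 ≤
      24 * ((m + 2) ^ 2 * (2 * m + 1)!) := by
  rcases m with _ | _ | m
  · norm_num [genusWeight_zero]
  · rw [Finset.Nat.antidiagonal_succ]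
    norm_num [genusWeight_zero, genusWeight_one, Nat.factorial]
  · have hinner : ∑ p ∈ antidiagonal m, genusWeight (p.1 + 1) * genusWeight (p.2 + 1) ≤
        (m + 1) * (24 * genusWeight (m + 1)) := by
      refine (Finset.sum_le_card_nsmul _ _ (24 * genusWeight (m + 1)) fun p hp => ?_).trans_eq ?_
      · exact (genusWeight_mul_le p.1 p.2).trans_eq (by rw [mem_antidiagonal.1 hp])
      · simp
    have hlast := genusWeight_le (m + 2)
    rw [Finset.Nat.sum_antidiagonal_succ, Finset.Nat.sum_antidiagonal_succ', genusWeight_zero]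
    linarith [mul_genusWeight_succ_le m]

/-- The factor of the stable bound in genus `g + 1` that depends on the genus only. -/
def genusConst (g : ℕ) : ℝ := (9 / 4) ^ g * (g + 1) ^ 3 / 24

/-- The correction of the stable bound in genus `g + 1` in the presence of `z` vanishing
indices. -/
def zeroFactor (g z : ℕ) : ℝ := (1 + 1 / (g + 1)) ^ min z 2

theorem genusConst_pos (g : ℕ) : 0 < genusConst g := by
  unfold genusConst
  positivity

theorem zeroFactor_pos (g z : ℕ) : 0 < zeroFactor g z := by
  unfold zeroFactor
  positivity

theorem zeroFactor_zero (g : ℕ) : zeroFactor g 0 = 1 := by simp [zeroFactor]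

theorem monotone_zeroFactor (g : ℕ) : Monotone (zeroFactor g) := fun z z' h => by
  unfold zeroFactor
  gcongr
  exact le_add_of_nonneg_right (by positivity)

theorem zeroFactor_succ {g z : ℕ} (hz : z < 2) :
    zeroFactor g (z + 1) = (1 + 1 / (g + 1)) * zeroFactor g z := by
  rw [zeroFactor, zeroFactor, min_eq_left hz.le, min_eq_left (Nat.succ_le_of_lt hz), pow_succ']

theorem zeroFactor_of_two_le {g z : ℕ} (hz : 2 ≤ z) : zeroFactor g z = zeroFactor g 2 := by
  rw [zeroFactor, zeroFactor, min_eq_right hz, min_self]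

theorem genusConst_mul_zeroFactor_two (m : ℕ) :
    genusConst m * zeroFactor m 2 = (9 / 4) ^ m * ((m + 1) * (m + 2) ^ 2) / 24 := by
  rw [genusConst, zeroFactor, min_self]
  field_simp
  ring

theorem genusConst_mul_zeroFactor_one (m : ℕ) :
    genusConst m * zeroFactor m 1 * (2 * m)! = (9 / 4) ^ m / 24 * genusWeight m := by
  rw [genusConst, zeroFactor, genusWeight, min_eq_left one_le_two, pow_one]
  field_simp
  ring

theorem genusConst_rec (m : ℕ) :
    9 / 4 * (genusConst m * zeroFactor m 2 + ∑ p ∈ antidiagonal m,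
      genusConst p.1 * zeroFactor p.1 1 * (genusConst p.2 * zeroFactor p.2 1) *
        ((2 * p.1)! * (2 * p.2)! / (2 * m + 1)!)) ≤ genusConst (m + 1) := by
  have hsum : ∑ p ∈ antidiagonal m,
      genusConst p.1 * zeroFactor p.1 1 * (genusConst p.2 * zeroFactor p.2 1) *
        ((2 * p.1)! * (2 * p.2)! / (2 * m + 1)!) =
      (9 / 4) ^ m / 24 ^ 2 / (2 * m + 1)! *
        ∑ p ∈ antidiagonal m, genusWeight p.1 * genusWeight p.2 := by
    rw [Finset.mul_sum]
    refine Finset.sum_congr rfl fun p hp => ?_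
    calc _ = genusConst p.1 * zeroFactor p.1 1 * (2 * p.1)! *
          (genusConst p.2 * zeroFactor p.2 1 * (2 * p.2)!) / (2 * m + 1)! := by ring
      _ = _ := by
        rw [genusConst_mul_zeroFactor_one, genusConst_mul_zeroFactor_one, ← mem_antidiagonal.1 hp,
          pow_add]
        ring
  rw [hsum, genusConst_mul_zeroFactor_two, genusConst]
  calc _ ≤ 9 / 4 * ((9 / 4 : ℝ) ^ m * ((m + 1) * (m + 2) ^ 2) / 24 +
        (9 / 4) ^ m / 24 ^ 2 / (2 * m + 1)! * (24 * ((m + 2) ^ 2 * (2 * m + 1)!))) := by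
        gcongr
        exact sum_genusWeight_le m
    _ = _ := by
      push_cast
      field_simp
      ring

end GenusWeight

/-! ### Positivity -/

section Order

variable {α : Type*}

theorem conv_nonneg {χ ψ : Multiset α → ℝ} {s : Multiset α}
    (h : ∀ t₁ t₂, t₁ + t₂ = s → 0 ≤ χ t₁ * ψ t₂) : 0 ≤ conv χ ψ s := by
  rw [conv_apply]
  refine Multiset.sum_nonneg fun c hc => ?_
  obtain ⟨t, ht, rfl⟩ := Multiset.mem_map.1 hc
  exact h _ _ (Multiset.mem_antidiagonal.1 ht)

variable [DecidableEq α]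

theorem removeSum_nonneg {ψ : α → Multiset α → ℝ} {s : Multiset α}
    (h : ∀ x ∈ s, 0 ≤ ψ x (s.erase x)) : 0 ≤ removeSum ψ s := by
  rw [removeSum_apply]
  refine Multiset.sum_nonneg fun c hc => ?_
  obtain ⟨x, hx, rfl⟩ := Multiset.mem_map.1 hc
  exact h x hx

theorem removeSum_le {ψ : α → Multiset α → ℝ} {s : Multiset α} {f : α → ℝ}
    (h : ∀ x ∈ s, ψ x (s.erase x) ≤ f x) : removeSum ψ s ≤ (s.map f).sum :=
  Multiset.sum_map_le_sum_map _ _ h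

theorem raise_le_raise {f : ℕ → ℝ} {W : ℕ → ℝ} {x : ℕ} (h : ∀ y, x = y + 1 → f y ≤ W y) :
    raise f x ≤ raise W x := by
  cases x with
  | zero => exact le_rfl
  | succ x => exact nsmul_le_nsmul_right (h x rfl) _

end Order

theorem card_le_sum_add_count_zero (s : Multiset ℕ) : s.card ≤ s.sum + s.count 0 := by
  induction s using Multiset.induction with
  | empty => simp
  | cons x s ih =>
    rw [Multiset.card_cons, Multiset.sum_cons, Multiset.count_cons]
    split_ifs <;> omega

theorem exists_card_eq_count_add (r : Multiset ℕ) :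
    ∃ m, r.card = r.count 0 + r.count 1 + m ∧ r.count 1 + 2 * m ≤ r.sum ∧
      (m = 0 → r.sum = r.count 1) := by
  induction r using Multiset.induction with
  | empty => exact ⟨0, by simp⟩
  | cons x r ih =>
    obtain ⟨m, hcard, hle, hsum⟩ := ih
    rcases x with - | - | x
    · exact ⟨m, by simp; omega, by simpa using hle, by simpa using hsum⟩
    · exact ⟨m, by simp; omega, by simp; omega, fun hm => by simp [hsum hm, add_comm]⟩
    · exact ⟨m + 1, by simp; omega, by simp; omega, by simp⟩

theorem virInit_nonneg (g k : ℕ) (s : Multiset ℕ) : (0 : ℝ) ≤ virInit g k s := by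
  unfold virInit
  have hsingle : ∀ (t : Multiset ℕ) (c : ℝ), 0 ≤ c → (0 : Multiset ℕ → ℝ) ≤ Pi.single t c :=
    fun t c hc => Pi.single_nonneg.2 hc
  refine add_nonneg ?_ ?_ <;> split_ifs
  exacts [hsingle _ _ zero_le_one s, le_rfl, hsingle _ _ (by norm_num) s, le_rfl]

namespace IsVirasoro

variable {a : ℝ} {v : ℕ → ℕ → Multiset ℕ → ℝ}

theorem genus_zero_eq_zero (hv : IsVirasoro a v) (k : ℕ) {s : Multiset ℕ} (hs : s.count 0 ≤ 1) :
    v 0 k s = 0 :=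
  hv.vanish _ _ _ (by have := card_le_sum_add_count_zero s; omega)

theorem virSplit_nonneg (hv : IsVirasoro a v) {g : ℕ} {s : Multiset ℕ}
    (ih : ∀ g' k' s', 2 * g' + s'.card < 2 * g + s.card → 0 ≤ v g' k' s') (p : ℕ × ℕ) :
    0 ≤ virSplit v v g p s := by
  rw [virSplit, Finset.sum_apply]
  refine Finset.sum_nonneg fun h hh => conv_nonneg fun t₁ t₂ ht => ?_
  have hgenus := mem_antidiagonal.1 hh
  have hcard : t₁.card + t₂.card = s.card := by rw [← ht, Multiset.card_add]
  have hcount₁ := Multiset.count_le_card 0 t₁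
  have hcount₂ := Multiset.count_le_card 0 t₂
  by_cases h₁ : h.1 = 0 ∧ t₁.card ≤ 1
  · rw [h₁.1, hv.genus_zero_eq_zero _ (by omega), zero_mul]
  by_cases h₂ : h.2 = 0 ∧ t₂.card ≤ 1
  · rw [h₂.1, hv.genus_zero_eq_zero _ (by omega), mul_zero]
  exact mul_nonneg (ih _ _ _ (by omega)) (ih _ _ _ (by omega))

theorem virQuad_nonneg (hv : IsVirasoro a v) {g : ℕ} {s : Multiset ℕ}
    (ih : ∀ g' k' s', 2 * g' + s'.card < 2 * g + s.card → 0 ≤ v g' k' s') (k : ℕ) :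
    0 ≤ virQuad v g k s := by
  have hloop : ∀ p, 0 ≤ virLoop v g p s := fun p => by
    cases g with
    | zero => exact le_rfl
    | succ g => exact ih _ _ _ (by rw [Multiset.card_cons]; omega)
  match k with
  | 0 => exact le_rfl
  | 1 => exact le_rfl
  | k + 2 =>
    rw [virQuad, Pi.smul_apply, Finset.sum_apply]
    exact smul_nonneg (by norm_num) (Finset.sum_nonneg fun p _ =>
      add_nonneg (hloop p) (hv.virSplit_nonneg ih p))

theorem nonneg (hv : IsVirasoro a v) (ha : 0 ≤ a) (g k : ℕ) (s : Multiset ℕ) : 0 ≤ v g k s := by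
  induction hn : 2 * g + s.card using Nat.strong_induction_on generalizing g k s with
  | _ n IH =>
  subst hn
  have ih : ∀ g' k' s', 2 * g' + s'.card < 2 * g + s.card → 0 ≤ v g' k' s' :=
    fun g' k' s' h => IH _ h g' k' s' rfl
  have hmerge : ∀ k, 0 ≤ removeSum (virMerge (v g) k) s := fun k =>
    removeSum_nonneg fun x hx => by
      have hcard := Multiset.card_erase_add_one hx
      unfold virMerge
      split_ifs
      · exact le_rfl
      · exact nsmul_nonneg (ih _ _ _ (by omega)) _
  have hdescend : ∀ j k, 3 * g + s.card < k + j + 2 → 0 ≤ v g k s := by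
    intro j
    induction j with
    | zero =>
      exact fun k hk => (hv.vanish _ _ _ (by omega)).ge
    | succ j ihj =>
      intro k hk
      have hshift := mul_nonneg ha (ihj (k + 1) (by omega))
      rw [hv.rec_eq]
      exact add_nonneg (add_nonneg (add_nonneg hshift (hmerge k)) (hv.virQuad_nonneg ih k))
        (virInit_nonneg g k s)
  exact hdescend (3 * g + s.card) k (by omega)

end IsVirasoro

section StringStep

/-- The shape `3ⁿ (q^ℓ / ℓ!) K!` of the bounds on amplitudes with `n` indices. -/
def growthFactor (q : ℝ) (n ℓ K : ℕ) : ℝ :=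
  3 ^ n * (q ^ ℓ / ℓ !) * K !

theorem growthFactor_nonneg {q : ℝ} (hq : 0 ≤ q) (n ℓ K : ℕ) : 0 ≤ growthFactor q n ℓ K := by
  unfold growthFactor
  positivity

theorem growthFactor_succ_succ (q : ℝ) (n ℓ K : ℕ) :
    growthFactor q (n + 1) ℓ (K + 1) = 3 * (K + 1) * growthFactor q n ℓ K := by
  rw [growthFactor, growthFactor, Nat.factorial_succ]
  push_cast
  ring

theorem mul_growthFactor_succ (q : ℝ) (n ℓ K : ℕ) :
    5 * q / 3 * growthFactor q (n + 1) ℓ K = 5 * (ℓ + 1) * growthFactor q n (ℓ + 1) K := by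
  rw [growthFactor, growthFactor, Nat.factorial_succ]
  push_cast
  field_simp
  ring

/-- The inductive bound on the amplitudes `f` of genus `g` with less than `M` tail entries plus
codegree `ℓ`. The weight `w` depends on the number of vanishing indices, and `K = 2g + n + ℓ - 3`
for amplitudes with `n` indices. -/
def BoundedBelow (q : ℝ) (w : ℕ → ℝ) (f : ℕ → Multiset ℕ → ℝ) (g M : ℕ) : Prop :=
  ∀ k s ℓ K, s.card + ℓ < M → k + s.sum + ℓ + 2 = 3 * g + s.card → K + 2 = 2 * g + s.card + ℓ →
    f k s ≤ w ((k ::ₘ s).count 0) * growthFactor q (s.card + 1) ℓ K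

theorem sum_map_raise_ite (r : Multiset ℕ) (b c : ℝ) :
    (r.map (raise fun x => if x = 0 then b else c)).sum =
      3 * r.count 1 * b + (2 * r.sum + r.card - r.count 0 - 3 * r.count 1) * c := by
  induction r using Multiset.induction with
  | empty => simp
  | cons x r ih =>
    rw [Multiset.map_cons, Multiset.sum_cons, ih]
    rcases x with - | - | x <;> simp [nsmul_eq_mul, -mul_eq_mul_right_iff] <;> ring

variable {a q : ℝ} {v : ℕ → ℕ → Multiset ℕ → ℝ} {w : ℕ → ℝ}

/-- If the vanishing index is the head, the recursion itself gives the bound, otherwise the string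
equation does. -/
theorem IsVirasoro.le_of_zero_mem (hv : IsVirasoro a v) {g k : ℕ} {s r : Multiset ℕ}
    (hr : k ::ₘ s = 0 ::ₘ r) (hinit : k = 0 → virInit g 0 s = (0 : ℝ)) {A : ℝ} {W : ℕ → ℝ}
    (hA : ∀ k' s', k' ::ₘ s' = 1 ::ₘ r → a * v g k' s' ≤ A)
    (hW : ∀ x, x + 1 ∈ r → ∀ k' s', k' ::ₘ s' = x ::ₘ r.erase (x + 1) → v g k' s' ≤ W x) :
    v g k s ≤ A + (r.map (raise W)).sum := by
  rcases Multiset.cons_eq_cons.1 hr with ⟨rfl, rfl⟩ | ⟨hk, t, rfl, rfl⟩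
  · have hrec := congrFun (hv.rec_eq g 0) s
    simp only [virQuad, virMerge_zero, add_zero, zero_add, Pi.add_apply, Pi.smul_apply,
      smul_eq_mul, hinit rfl] at hrec
    rw [hrec]
    refine add_le_add (hA 1 s rfl) (removeSum_le fun x hx => ?_)
    rw [raise_apply]
    refine raise_le_raise fun y hy => ?_
    subst hy
    exact hW y hx _ _ rfl
  · have hstring := congrFun (hv.stringOp_eq g k) t
    simp only [stringOp_def, stringSource, pderiv_virInit_zero, hk, and_false, if_false, add_zero,
      Pi.sub_apply, Pi.smul_apply, smul_eq_mul, pderiv_apply, lowerSum_def, raise_apply] at hstring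
    have hhead : raise (fun x => v g x t) k ≤ raise W k := raise_le_raise fun y hy => by
      subst hy
      exact hW y (Multiset.mem_cons_self _ _) y t (by rw [Multiset.erase_cons_head])
    have htail : removeSum (raise fun x => pderiv x (v g k)) t ≤ (t.map (raise W)).sum := by
      refine removeSum_le fun x hx => ?_
      rw [raise_apply]
      refine raise_le_raise fun y hy => ?_
      subst hy
      refine hW y (Multiset.mem_cons_of_mem hx) k _ ?_
      rw [Multiset.erase_cons_tail_of_mem hx, Multiset.cons_swap]
    have hshift := hA k (1 ::ₘ t) (Multiset.cons_swap _ _ _)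
    rw [Multiset.map_cons, Multiset.sum_cons]
    linarith

theorem IsVirasoro.mul_le_of_boundedBelow (hq : 0 ≤ q) (hv : IsVirasoro (5 * q / 3) v)
    {g k ℓ K : ℕ} {s : Multiset ℕ} (hb : BoundedBelow q w (v g) g (s.card + ℓ))
    (hdim : k + s.sum + ℓ + 1 = 3 * g + s.card) (hK : K + 3 = 2 * g + s.card + ℓ) :
    5 * q / 3 * v g k s ≤ 5 * ℓ * (w ((k ::ₘ s).count 0) * growthFactor q s.card ℓ K) := by
  cases ℓ with
  | zero => simp [hv.vanish g k s (by omega)]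
  | succ ℓ =>
    calc 5 * q / 3 * v g k s
        ≤ 5 * q / 3 * (w ((k ::ₘ s).count 0) * growthFactor q (s.card + 1) ℓ K) := by
          gcongr
          exact hb k s ℓ K (by omega) (by omega) (by omega)
      _ = _ := by
        rw [mul_left_comm, mul_growthFactor_succ]
        push_cast
        ring

theorem IsVirasoro.string_step (hq : 0 ≤ q) (hv : IsVirasoro (5 * q / 3) v)
    {g k ℓ K : ℕ} {s r : Multiset ℕ} (hb : BoundedBelow q w (v g) g (s.card + ℓ))
    (hr : k ::ₘ s = 0 ::ₘ r) (hinit : k = 0 → virInit g 0 s = (0 : ℝ))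
    (hdim : k + s.sum + ℓ + 2 = 3 * g + s.card) (hK : K + 3 = 2 * g + s.card + ℓ)
    (hw : 5 * ℓ * w (r.count 0) + (3 * r.count 1 * w (r.count 0 + 1) +
      (2 * r.sum + r.card - r.count 0 - 3 * r.count 1) * w (r.count 0)) ≤
        3 * (K + 1) * w (r.count 0 + 1)) :
    v g k s ≤ w ((k ::ₘ s).count 0) * growthFactor q (s.card + 1) ℓ (K + 1) := by
  set U := growthFactor q s.card ℓ K
  have hcard : s.card = r.card := by simpa using congrArg Multiset.card hr
  have hsum : k + s.sum = r.sum := by simpa using congrArg Multiset.sum hr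
  have hmain := hv.le_of_zero_mem hr hinit (A := 5 * ℓ * (w (r.count 0) * U))
    (W := fun x => if x = 0 then w (r.count 0 + 1) * U else w (r.count 0) * U) ?_ ?_
  · rw [sum_map_raise_ite] at hmain
    rw [hr, Multiset.count_cons_self, growthFactor_succ_succ]
    calc v g k s ≤ _ := hmain
      _ = (5 * ℓ * w (r.count 0) + (3 * r.count 1 * w (r.count 0 + 1) +
          (2 * r.sum + r.card - r.count 0 - 3 * r.count 1) * w (r.count 0))) * U := by ring
      _ ≤ 3 * (K + 1) * w (r.count 0 + 1) * U :=
        mul_le_mul_of_nonneg_right hw (growthFactor_nonneg hq _ _ _)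
      _ = _ := by ring
  · intro k' s' h
    have hcard' : s'.card = s.card := by simpa [hcard] using congrArg Multiset.card h
    have hsum' : k' + s'.sum = 1 + r.sum := by simpa using congrArg Multiset.sum h
    have := hv.mul_le_of_boundedBelow hq (hcard'.symm ▸ hb) (k := k') (K := K) (by omega) (by omega)
    rwa [h, Multiset.count_cons_of_ne zero_ne_one, hcard'] at this
  · intro x hx k' s' h
    have herase := Multiset.card_erase_add_one hx
    have hsumErase := Multiset.sum_erase hx
    have hcard' := congrArg Multiset.card h
    have hsum' := congrArg Multiset.sum h
    rw [Multiset.card_cons, Multiset.card_cons] at hcard'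
    rw [Multiset.sum_cons, Multiset.sum_cons] at hsum'
    have hle := hb k' s' ℓ K (by omega) (by omega) (by omega)
    rw [h, Multiset.count_cons, Multiset.count_erase_of_ne (by omega),
      show s'.card + 1 = s.card by omega] at hle
    split_ifs with hx0
    · rwa [if_pos hx0.symm] at hle
    · rwa [if_neg (Ne.symm hx0), add_zero] at hle

end StringStep

/-! ### Bounds on the Virasoro amplitudes -/

section StableBound

variable {a q : ℝ} {v : ℕ → ℕ → Multiset ℕ → ℝ}

theorem BoundedBelow.mono {w : ℕ → ℝ} {f : ℕ → Multiset ℕ → ℝ} {g M N : ℕ}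
    (h : BoundedBelow q w f g N) (hMN : M ≤ N) : BoundedBelow q w f g M :=
  fun k s ℓ K hM => h k s ℓ K (hM.trans_le hMN)

theorem IsVirasoro.genus_zero_boundedBelow (hq : 0 ≤ q) (hv : IsVirasoro (5 * q / 3) v) (M : ℕ) :
    BoundedBelow q (fun z => (5 / 6) ^ z) (v 0) 0 M := by
  induction M with
  | zero => exact fun k s ℓ K hM => absurd hM (Nat.not_lt_zero _)
  | succ M ih =>
    intro k s ℓ K hM hdim hK
    have hmem : 0 ∈ k ::ₘ s := by
      have hcard := card_le_sum_add_count_zero (k ::ₘ s)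
      rw [Multiset.card_cons, Multiset.sum_cons] at hcard
      exact Multiset.count_pos.1 (by omega)
    obtain ⟨r, hr⟩ := Multiset.exists_cons_of_mem hmem
    have hcard : s.card = r.card := by simpa using congrArg Multiset.card hr
    have hsum : k + s.sum = r.sum := by simpa using congrArg Multiset.sum hr
    rcases K with - | K
    · obtain ⟨x, y, rfl⟩ := Multiset.card_eq_two.1 (show s.card = 2 by omega)
      simp only [Multiset.insert_eq_cons, Multiset.sum_cons, Multiset.sum_singleton] at hdim hsum
      obtain ⟨rfl, rfl, rfl, rfl⟩ : k = 0 ∧ x = 0 ∧ y = 0 ∧ ℓ = 0 := by simp at hK hdim; omega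
      rw [hv.rec_eq, Pi.add_apply, Pi.add_apply, Pi.add_apply, Pi.smul_apply,
        hv.vanish 0 _ _ (by simp)]
      norm_num [removeSum_apply, virMerge_zero, virQuad, virInit, Multiset.insert_eq_cons,
        growthFactor]
    refine hv.string_step hq (ih.mono (by omega)) hr ?_ hdim (by omega) ?_
    · rintro rfl
      have hs : s ≠ 0 ::ₘ {0} := by
        rintro rfl
        simp at hK hdim
        omega
      simp [virInit, hs]
    obtain ⟨m, hm, hle, -⟩ := exists_card_eq_count_add r
    have hle' : (r.count 1 + 2 * m : ℝ) ≤ r.sum := by exact_mod_cast hle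
    have hK' : (r.sum + 2 * ℓ : ℝ) = K + 1 := by exact_mod_cast (show _ = K + 1 by omega)
    have hpow : (0 : ℝ) ≤ (5 / 6) ^ r.count 0 := by positivity
    have hm' : (r.card : ℝ) = r.count 0 + r.count 1 + m := by exact_mod_cast hm
    rw [hm', pow_succ]
    nlinarith

theorem zeroFactor_string_step {g ℓ K : ℕ} {r : Multiset ℕ}
    (hdim : r.sum + ℓ + 2 = 3 * (g + 1) + r.card) (hK : K + 3 = 2 * (g + 1) + r.card + ℓ) :
    5 * ℓ * zeroFactor g (r.count 0) + (3 * r.count 1 * zeroFactor g (r.count 0 + 1) +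
      (2 * r.sum + r.card - r.count 0 - 3 * r.count 1) * zeroFactor g (r.count 0)) ≤
        3 * (K + 1) * zeroFactor g (r.count 0 + 1) := by
  obtain ⟨m, hm, -, hsum⟩ := exists_card_eq_count_add r
  set z := r.count 0
  set o := r.count 1
  have hdim' : (r.sum + ℓ + 2 : ℝ) = 3 * (g + 1) + r.card := by exact_mod_cast hdim
  have hK' : (K + 3 : ℝ) = 2 * (g + 1) + r.card + ℓ := by exact_mod_cast hK
  have hm' : (r.card : ℝ) = z + o + m := by exact_mod_cast hm
  set Q : ℝ := 6 * g + 2 + 2 * z + 3 * m + 3 * ℓ with hQ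
  suffices h : Q * zeroFactor g z ≤ (Q + z - 2) * zeroFactor g (z + 1) by
    have hleft : (5 * ℓ + (2 * r.sum + r.card - z - 3 * o) : ℝ) = Q := by linarith
    have hright : (3 * (K + 1) - 3 * o : ℝ) = Q + z - 2 := by linarith
    rw [← hright, ← hleft] at h
    linarith
  rcases lt_or_ge z 2 with hz | hz
  · have hQz : (2 - z) * (g + 2) ≤ Q := by
      have hcases : (2 - z) * (g + 2) ≤ 6 * g + 2 + 2 * z + 3 * m + 3 * ℓ := by
        interval_cases z <;> omega
      have hcast : ((2 - z : ℕ) : ℝ) = 2 - z := by push_cast [hz.le]; ring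
      rw [← hcast, hQ]
      exact_mod_cast hcases
    rw [zeroFactor_succ hz, ← mul_assoc]
    refine mul_le_mul_of_nonneg_right ?_ (zeroFactor_pos g z).le
    rw [one_add_div (by positivity), mul_div_assoc', le_div_iff₀ (by positivity)]
    linarith
  · rw [zeroFactor_of_two_le hz, zeroFactor_of_two_le (hz.trans z.le_succ)]
    refine mul_le_mul_of_nonneg_right ?_ (zeroFactor_pos g 2).le
    have : (2 : ℝ) ≤ z := by exact_mod_cast hz
    linarith

theorem sum_antidiagonal_mul_le {f g F G : ℕ → ℝ} {k ℓ a₁ a₂ c₁ c₂ : ℕ}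
    (hk : k + ℓ + c₁ + c₂ = a₁ + a₂) (hg : ∀ j, 0 ≤ g j) (hF : ∀ l, 0 ≤ F l) (hG : ∀ l, 0 ≤ G l)
    (hfF : ∀ i l, i + l + c₁ = a₁ → f i ≤ F l) (hf : ∀ i, a₁ < i + c₁ → f i = 0)
    (hgG : ∀ j l, j + l + c₂ = a₂ → g j ≤ G l) (hg0 : ∀ j, a₂ < j + c₂ → g j = 0) :
    ∑ p ∈ antidiagonal k, f p.1 * g p.2 ≤ ∑ L ∈ antidiagonal ℓ, F L.1 * G L.2 := by
  let P := (antidiagonal k).filter fun p => p.1 + c₁ ≤ a₁ ∧ p.2 + c₂ ≤ a₂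
  let e : ℕ × ℕ → ℕ × ℕ := fun p => (a₁ - (p.1 + c₁), a₂ - (p.2 + c₂))
  have hP : ∀ p ∈ P, p.1 + p.2 = k ∧ p.1 + c₁ ≤ a₁ ∧ p.2 + c₂ ≤ a₂ := fun p hp => by
    simpa [P] using hp
  have hinj : Set.InjOn e P := fun p hp p' hp' hpp => by
    have := hP p hp
    have := hP p' hp'
    simp only [e, Prod.mk.injEq] at hpp
    exact Prod.ext (by omega) (by omega)
  calc ∑ p ∈ antidiagonal k, f p.1 * g p.2
      = ∑ p ∈ P, f p.1 * g p.2 := by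
        refine (Finset.sum_filter_of_ne fun p _ hne => ?_).symm
        by_contra hp
        rcases not_and_or.1 hp with hp | hp
        · exact hne (by rw [hf _ (by omega), zero_mul])
        · exact hne (by rw [hg0 _ (by omega), mul_zero])
    _ ≤ ∑ p ∈ P, F (e p).1 * G (e p).2 := Finset.sum_le_sum fun p hp => by
        have := hP p hp
        exact mul_le_mul (hfF _ _ (by simp only [e]; omega)) (hgG _ _ (by simp only [e]; omega))
          (hg _) (hF _)
    _ = ∑ L ∈ P.image e, F L.1 * G L.2 := (Finset.sum_image (f := fun L => F L.1 * G L.2) hinj).symm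
    _ ≤ ∑ L ∈ antidiagonal ℓ, F L.1 * G L.2 := by
        refine Finset.sum_le_sum_of_subset_of_nonneg (Finset.image_subset_iff.2 fun p hp => ?_)
          fun L _ _ => mul_nonneg (hF _) (hG _)
        have := hP p hp
        rw [mem_antidiagonal]
        simp only [e]
        omega

theorem growthFactor_mul_growthFactor (q : ℝ) (n₁ n₂ l₁ l₂ K₁ K₂ : ℕ) :
    growthFactor q (n₁ + 1) l₁ K₁ * growthFactor q (n₂ + 1) l₂ K₂ =
      9 * 3 ^ (n₁ + n₂) * q ^ (l₁ + l₂) * ((K₁ ! / l₁ ! : ℝ) * (K₂ ! / l₂ !)) := by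
  simp only [growthFactor, pow_add]
  ring

theorem sum_growthFactor_mul_growthFactor (q : ℝ) (s : Multiset ℕ) (a b ℓ : ℕ) :
    (s.antidiagonal.map fun t => ∑ L ∈ antidiagonal ℓ,
      growthFactor q (t.1.card + 1) L.1 (a + t.1.card + L.1) *
        growthFactor q (t.2.card + 1) L.2 (b + t.2.card + L.2)).sum =
      (a ! * b ! / (a + b + 1)! : ℝ) * (9 * growthFactor q s.card ℓ (a + b + 1 + s.card + ℓ)) := by
  have hterm : ∀ t ∈ s.antidiagonal, (∑ L ∈ antidiagonal ℓ,
      growthFactor q (t.1.card + 1) L.1 (a + t.1.card + L.1) *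
        growthFactor q (t.2.card + 1) L.2 (b + t.2.card + L.2)) =
      9 * 3 ^ s.card * q ^ ℓ * ∑ L ∈ antidiagonal ℓ,
        ((a + t.1.card + L.1)! / L.1 ! : ℝ) * ((b + t.2.card + L.2)! / L.2 !) := fun t ht => by
    rw [Finset.mul_sum]
    refine Finset.sum_congr rfl fun L hL => ?_
    rw [growthFactor_mul_growthFactor, mem_antidiagonal.1 hL, ← Multiset.card_add,
      Multiset.mem_antidiagonal.1 ht]
  rw [Multiset.map_congr rfl hterm, Multiset.sum_map_mul_left, sum_map_antidiagonal_factorial_div,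
    growthFactor]
  ring

namespace IsVirasoro

/-- A genus zero factor vanishes, because its entries are positive. -/
theorem virSplit_one_apply_eq_zero (hv : IsVirasoro a v) {s : Multiset ℕ} (hs : s.count 0 = 0)
    (p : ℕ × ℕ) : virSplit v v 1 p s = 0 := by
  rw [virSplit, Finset.sum_apply]
  refine Finset.sum_eq_zero fun h hh => conv_apply_eq_zero fun t₁ t₂ ht => ?_
  rw [← ht, Multiset.count_add] at hs
  have hgenus := mem_antidiagonal.1 hh
  rcases Nat.eq_zero_or_pos h.1 with h0 | h0
  · rw [h0, hv.genus_zero_eq_zero _ (by omega), zero_mul]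
  · rw [show h.2 = 0 by omega, hv.genus_zero_eq_zero _ (by omega), mul_zero]

theorem virSplit_add_two_apply (hv : IsVirasoro a v) {s : Multiset ℕ}
    (hs : s.count 0 = 0) (m : ℕ) (p : ℕ × ℕ) : virSplit v v (m + 2) p s =
      ∑ h ∈ antidiagonal m, conv (v (h.1 + 1) p.1) (v (h.2 + 1) p.2) s := by
  have hcount : ∀ t₁ t₂ : Multiset ℕ, t₁ + t₂ = s → t₁.count 0 = 0 ∧ t₂.count 0 = 0 :=
    fun t₁ t₂ ht => by rwa [← ht, Multiset.count_add, Nat.add_eq_zero_iff] at hs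
  have hleft : conv (v 0 p.1) (v (m + 2) p.2) s = 0 := conv_apply_eq_zero fun t₁ t₂ ht => by
    rw [hv.genus_zero_eq_zero _ (by simp [hcount t₁ t₂ ht]), zero_mul]
  have hright : conv (v (m + 2) p.1) (v 0 p.2) s = 0 := conv_apply_eq_zero fun t₁ t₂ ht => by
    rw [hv.genus_zero_eq_zero _ (by simp [hcount t₁ t₂ ht]), mul_zero]
  rw [virSplit, Finset.sum_apply, Finset.Nat.sum_antidiagonal_succ, hleft, zero_add,
    Finset.Nat.sum_antidiagonal_succ', hright, zero_add]

theorem sum_conv_le (hq : 0 ≤ q) (hv : IsVirasoro (5 * q / 3) v) {c₁ c₂ : ℝ} (hc₁ : 0 ≤ c₁)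
    (hc₂ : 0 ≤ c₂) {h₁ h₂ k ℓ : ℕ} {s : Multiset ℕ}
    (hb₁ : ∀ i t l, i + t.sum + l + 2 = 3 * (h₁ + 1) + t.card → t ≤ s →
      v (h₁ + 1) i t ≤ c₁ * growthFactor q (t.card + 1) l (2 * h₁ + t.card + l))
    (hb₂ : ∀ i t l, i + t.sum + l + 2 = 3 * (h₂ + 1) + t.card → t ≤ s →
      v (h₂ + 1) i t ≤ c₂ * growthFactor q (t.card + 1) l (2 * h₂ + t.card + l))
    (hdim : k + s.sum + ℓ + 4 = 3 * (h₁ + h₂ + 2) + s.card) :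
    ∑ p ∈ antidiagonal k, conv (v (h₁ + 1) p.1) (v (h₂ + 1) p.2) s ≤
      c₁ * c₂ * (((2 * h₁)! * (2 * h₂)! / (2 * h₁ + 2 * h₂ + 1)! : ℝ) *
        (9 * growthFactor q s.card ℓ (2 * h₁ + 2 * h₂ + 1 + s.card + ℓ))) := by
  have hnonneg := hv.nonneg (by positivity)
  have hgrowth := growthFactor_nonneg hq
  rw [sum_conv_apply, ← sum_growthFactor_mul_growthFactor, ← Multiset.sum_map_mul_left]
  refine Multiset.sum_map_le_sum_map _ _ fun t ht => ?_
  have ht' := Multiset.mem_antidiagonal.1 ht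
  have hcard : t.1.card + t.2.card = s.card := by rw [← Multiset.card_add, ht']
  have hsum : t.1.sum + t.2.sum = s.sum := by rw [← Multiset.sum_add, ht']
  rw [Finset.mul_sum]
  simp only [mul_mul_mul_comm c₁ c₂]
  exact sum_antidiagonal_mul_le (a₁ := 3 * (h₁ + 1) + t.1.card) (c₁ := t.1.sum + 2)
    (a₂ := 3 * (h₂ + 1) + t.2.card) (c₂ := t.2.sum + 2)
    (F := fun l => c₁ * growthFactor q (t.1.card + 1) l (2 * h₁ + t.1.card + l))
    (G := fun l => c₂ * growthFactor q (t.2.card + 1) l (2 * h₂ + t.2.card + l)) (by omega)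
    (fun _ => hnonneg _ _ _) (fun _ => mul_nonneg hc₁ (hgrowth _ _ _))
    (fun _ => mul_nonneg hc₂ (hgrowth _ _ _))
    (fun i l hi => hb₁ i t.1 l (by omega) (ht' ▸ Multiset.le_add_right _ _))
    (fun i hi => hv.vanish _ _ _ (by omega))
    (fun j l hj => hb₂ j t.2 l (by omega) (ht' ▸ Multiset.le_add_left _ _))
    (fun j hj => hv.vanish _ _ _ (by omega))

end IsVirasoro

/-- The weight in the bounds on amplitudes of genus `g + 1` with `z` vanishing indices. -/
def stableWeight (g z : ℕ) : ℝ := genusConst g * zeroFactor g z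

theorem stableWeight_nonneg (g z : ℕ) : 0 ≤ stableWeight g z :=
  (mul_pos (genusConst_pos g) (zeroFactor_pos g z)).le

theorem monotone_stableWeight (g : ℕ) : Monotone (stableWeight g) :=
  (monotone_zeroFactor g).const_mul (genusConst_pos g).le

theorem BoundedBelow.le_of_count_le {f : ℕ → Multiset ℕ → ℝ} {g k z ℓ K : ℕ} {s : Multiset ℕ}
    (hq : 0 ≤ q) (hb : ∀ M, BoundedBelow q (stableWeight g) f (g + 1) M)
    (hs : (k ::ₘ s).count 0 ≤ z) (hdim : k + s.sum + ℓ + 2 = 3 * (g + 1) + s.card)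
    (hK : K = 2 * g + s.card + ℓ) :
    f k s ≤ stableWeight g z * growthFactor q (s.card + 1) ℓ K :=
  (hb _ k s ℓ K (Nat.lt_succ_self _) hdim (by omega)).trans <|
    mul_le_mul_of_nonneg_right (monotone_stableWeight g hs) (growthFactor_nonneg hq _ _ _)

namespace IsVirasoro

theorem sum_virLoop_le (hq : 0 ≤ q) {g k ℓ K : ℕ} {s : Multiset ℕ} (hs : s.count 0 = 0)
    (hb : ∀ M, BoundedBelow q (stableWeight g) (v (g + 1)) (g + 1) M)
    (hdim : k + s.sum + ℓ + 1 = 3 * (g + 1) + s.card) (hK : K = 2 * g + s.card + ℓ + 1) :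
    ∑ p ∈ antidiagonal k, virLoop v (g + 2) p s ≤
      (k + 1) * (stableWeight g 2 * (9 * growthFactor q s.card ℓ K)) := by
  have hbound : ∀ p ∈ antidiagonal k, virLoop v (g + 2) p s ≤
      stableWeight g 2 * (9 * growthFactor q s.card ℓ K) := fun p hp => by
    have hsum := mem_antidiagonal.1 hp
    have hcount : (p.1 ::ₘ p.2 ::ₘ s).count 0 ≤ 2 := by
      rw [Multiset.count_cons, Multiset.count_cons, hs]
      split_ifs <;> omega
    have hle := BoundedBelow.le_of_count_le (ℓ := ℓ) hq hb hcount
      (by simp only [Multiset.card_cons, Multiset.sum_cons]; omega)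
      (show K = _ by rw [Multiset.card_cons]; omega)
    have hgrowth : growthFactor q (s.card + 1 + 1) ℓ K = 9 * growthFactor q s.card ℓ K := by
      simp only [growthFactor, pow_succ]
      ring
    rwa [Multiset.card_cons, hgrowth] at hle
  have hcard := Finset.sum_le_card_nsmul _ _ _ hbound
  rw [Finset.Nat.card_antidiagonal, nsmul_eq_mul] at hcard
  exact_mod_cast hcard

theorem sum_virSplit_le (hq : 0 ≤ q) (hv : IsVirasoro (5 * q / 3) v) {m k ℓ K : ℕ}
    {s : Multiset ℕ} (hs : s.count 0 = 0)
    (hb : ∀ g ≤ m, ∀ M, BoundedBelow q (stableWeight g) (v (g + 1)) (g + 1) M)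
    (hdim : k + s.sum + ℓ + 4 = 3 * (m + 2) + s.card) (hK : K = 2 * m + 1 + s.card + ℓ) :
    ∑ p ∈ antidiagonal k, virSplit v v (m + 2) p s ≤
      (∑ h ∈ antidiagonal m, stableWeight h.1 1 * stableWeight h.2 1 *
        ((2 * h.1)! * (2 * h.2)! / (2 * m + 1)!)) * (9 * growthFactor q s.card ℓ K) := by
  simp only [hv.virSplit_add_two_apply hs]
  rw [Finset.sum_comm, Finset.sum_mul]
  refine Finset.sum_le_sum fun h hh => ?_
  have hm := mem_antidiagonal.1 hh
  have hbound : ∀ g ≤ m, ∀ i t l, i + t.sum + l + 2 = 3 * (g + 1) + t.card → t ≤ s →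
      v (g + 1) i t ≤ stableWeight g 1 * growthFactor q (t.card + 1) l (2 * g + t.card + l) :=
    fun g hg i t l hdim ht => BoundedBelow.le_of_count_le hq (hb g hg)
      (by have := Multiset.count_le_of_le 0 ht; rw [Multiset.count_cons]; split_ifs <;> omega)
      hdim rfl
  refine (hv.sum_conv_le hq (stableWeight_nonneg _ _) (stableWeight_nonneg _ _)
    (ℓ := ℓ) (hbound h.1 (by omega)) (hbound h.2 (by omega)) (by omega)).trans_eq ?_
  rw [← Nat.mul_add, hm, hK, mul_assoc, mul_assoc, mul_assoc]

theorem virQuad_le (hq : 0 ≤ q) (hv : IsVirasoro (5 * q / 3) v) {g k ℓ K : ℕ} {s : Multiset ℕ}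
    (hs : s.count 0 = 0)
    (hb : ∀ h < g, ∀ M, BoundedBelow q (stableWeight h) (v (h + 1)) (h + 1) M)
    (hdim : k + s.sum + ℓ + 1 = 3 * g + s.card) (hK : K + 1 = 2 * g + s.card + ℓ) :
    virQuad v (g + 1) (k + 2) s ≤ 2 * (k + 1) * (genusConst g * growthFactor q s.card ℓ K) := by
  have hgrowth := growthFactor_nonneg hq s.card ℓ K
  rw [virQuad, Pi.smul_apply, Finset.sum_apply, smul_eq_mul]
  rcases g with - | m
  · have hzero : ∀ p, virLoop v 1 p s + virSplit v v 1 p s = 0 := fun p => by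
      rw [hv.virSplit_one_apply_eq_zero hs, add_zero]
      exact hv.genus_zero_eq_zero _ (by rw [Multiset.count_cons]; split_ifs <;> omega)
    simp only [Pi.add_apply, hzero, Finset.sum_const_zero, mul_zero]
    exact mul_nonneg (by positivity) (mul_nonneg (genusConst_pos 0).le hgrowth)
  · have hloop := sum_virLoop_le hq (k := k) (ℓ := ℓ) (K := K) hs (hb m m.lt_succ_self) (by omega)
      (by omega)
    have hsplit := hv.sum_virSplit_le hq (k := k) (ℓ := ℓ) (K := K) hs
      (fun h hh => hb h (Nat.lt_succ_of_le hh)) (by omega) (by omega)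
    set A := stableWeight m 2
    set B := ∑ h ∈ antidiagonal m, stableWeight h.1 1 * stableWeight h.2 1 *
      ((2 * h.1)! * (2 * h.2)! / (2 * m + 1)! : ℝ)
    set U := growthFactor q s.card ℓ K
    have hB : 0 ≤ B := Finset.sum_nonneg fun h _ => mul_nonneg
      (mul_nonneg (stableWeight_nonneg _ _) (stableWeight_nonneg _ _)) (by positivity)
    simp only [Pi.add_apply, Finset.sum_add_distrib]
    calc _ ≤ 1 / 2 * ((k + 1) * (A * (9 * U)) + (k + 1) * (B * (9 * U))) := by
          have : B * (9 * U) ≤ (k + 1) * (B * (9 * U)) :=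
            le_mul_of_one_le_left (by positivity) (by simp)
          gcongr
          exact hsplit.trans this
      _ = 2 * (k + 1) * (9 / 4 * (A + B) * U) := by ring
      _ ≤ 2 * (k + 1) * (genusConst (m + 1) * U) := by
          gcongr
          exact genusConst_rec m

theorem removeSum_virMerge_le {f : ℕ → Multiset ℕ → ℝ} {g k ℓ K : ℕ}
    {s : Multiset ℕ} (hs : s.count 0 = 0)
    (hb : BoundedBelow q (stableWeight g) f (g + 1) (s.card + ℓ))
    (hdim : k + s.sum + ℓ = 3 * g + s.card) (hK : K + 1 = 2 * g + s.card + ℓ) :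
    removeSum (virMerge f (k + 1)) s ≤
      (2 * s.sum + s.card) * (stableWeight g 0 * growthFactor q s.card ℓ K) := by
  set U := stableWeight g 0 * growthFactor q s.card ℓ K
  have hterm : ∀ x ∈ s, virMerge f (k + 1) x (s.erase x) ≤ (2 * x + 1) * U := fun x hx => by
    have hx0 : x ≠ 0 := by
      rintro rfl
      exact Multiset.count_eq_zero.1 hs hx
    have hcard := Multiset.card_erase_add_one hx
    have hsum := Multiset.sum_erase hx
    have hcount : ((k + x) ::ₘ s.erase x).count 0 = 0 := by
      rw [Multiset.count_cons_of_ne (by omega), Multiset.count_erase_of_ne hx0.symm, hs]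
    have hle := hb (k + x) (s.erase x) ℓ K (by omega) (by omega) (by omega)
    rw [hcount, hcard] at hle
    rw [virMerge_succ, Pi.smul_apply, nsmul_eq_mul]
    push_cast
    gcongr
  refine (removeSum_le hterm).trans_eq ?_
  rw [Multiset.sum_map_mul_right, Multiset.sum_map_add, Multiset.sum_map_mul_left]
  simp [Nat.cast_multiset_sum]

theorem le_of_count_zero (hq : 0 ≤ q) (hv : IsVirasoro (5 * q / 3) v) {g k ℓ K : ℕ}
    {s : Multiset ℕ} (hs : s.count 0 = 0)
    (hlower : ∀ h < g, ∀ M, BoundedBelow q (stableWeight h) (v (h + 1)) (h + 1) M)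
    (hb : BoundedBelow q (stableWeight g) (v (g + 1)) (g + 1) (s.card + ℓ))
    (hdim : k + s.sum + ℓ = 3 * g + s.card) (hK : K + 1 = 2 * g + s.card + ℓ) :
    v (g + 1) (k + 1) s ≤ stableWeight g 0 * growthFactor q (s.card + 1) ℓ (K + 1) := by
  set U := stableWeight g 0 * growthFactor q s.card ℓ K with hU
  have hU0 : 0 ≤ U := mul_nonneg (stableWeight_nonneg g 0) (growthFactor_nonneg hq _ _ _)
  have hshift : 5 * q / 3 * v (g + 1) (k + 2) s ≤ 5 * ℓ * U := by
    have := hv.mul_le_of_boundedBelow hq hb (k := k + 2) (K := K) (by omega) (by omega)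
    rwa [Multiset.count_cons_of_ne (by omega), hs] at this
  have hmerge := removeSum_virMerge_le (k := k) (K := K) hs hb hdim hK
  have hquad : virQuad v (g + 1) (k + 1) s ≤ 2 * k * U := by
    rcases k with - | k
    · simp [virQuad]
    · have := hv.virQuad_le hq (k := k) (K := K) hs hlower (by omega) hK
      rw [hU, stableWeight, zeroFactor_zero, mul_one]
      exact_mod_cast this
  have hinit : virInit (g + 1) (k + 1) s = (0 : ℝ) := by
    by_cases hgk : g = 0 ∧ k = 0
    · have hs0 : s ≠ 0 := by
        rintro rfl
        simp [hgk] at hdim hK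
        omega
      simp [virInit, hgk, hs0]
    · simp [virInit, hgk]
  have hdim' : (k + s.sum + ℓ : ℝ) = 3 * g + s.card := by exact_mod_cast hdim
  have hK' : (K + 1 : ℝ) = 2 * g + s.card + ℓ := by exact_mod_cast hK
  calc v (g + 1) (k + 1) s
      = 5 * q / 3 * v (g + 1) (k + 2) s + removeSum (virMerge (v (g + 1)) (k + 1)) s +
          virQuad v (g + 1) (k + 1) s := by
        rw [hv.rec_eq, Pi.add_apply, Pi.add_apply, Pi.add_apply, hinit, add_zero, Pi.smul_apply,
          smul_eq_mul]
    _ ≤ 5 * ℓ * U + (2 * s.sum + s.card) * U + 2 * k * U := by gcongr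
    _ = (5 * ℓ + (2 * s.sum + s.card) + 2 * k) * U := by ring
    _ = 3 * (K + 1) * U := by
        congr 1
        linarith
    _ = _ := by
        rw [growthFactor_succ_succ, hU]
        ring

theorem boundedBelow (hq : 0 ≤ q) (hv : IsVirasoro (5 * q / 3) v) (g M : ℕ) :
    BoundedBelow q (stableWeight g) (v (g + 1)) (g + 1) M := by
  induction g using Nat.strong_induction_on generalizing M with
  | _ g hlower =>
  induction M with
  | zero => exact fun k s ℓ K hM => absurd hM (Nat.not_lt_zero _)
  | succ M ih =>
    intro k s ℓ K hM hdim hK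
    rcases K with - | K
    · obtain rfl : s = 0 := Multiset.card_eq_zero.1 (by omega)
      obtain ⟨rfl, rfl, rfl⟩ : g = 0 ∧ k = 1 ∧ ℓ = 0 := by simp at hdim hK; omega
      rw [hv.rec_eq, Pi.add_apply, Pi.add_apply, Pi.add_apply, Pi.smul_apply,
        hv.vanish 1 _ _ (by simp)]
      norm_num [virQuad, virInit, growthFactor, stableWeight, genusConst, zeroFactor]
    by_cases hmem : 0 ∈ k ::ₘ s
    · obtain ⟨r, hr⟩ := Multiset.exists_cons_of_mem hmem
      have hcard : s.card = r.card := by simpa using congrArg Multiset.card hr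
      have hsum : k + s.sum = r.sum := by simpa using congrArg Multiset.sum hr
      refine hv.string_step hq (ih.mono (by omega)) hr (fun _ => by simp [virInit]) hdim
        (by omega) ?_
      have := mul_le_mul_of_nonneg_left (zeroFactor_string_step (g := g) (ℓ := ℓ) (K := K) (r := r)
        (by omega) (by omega)) (genusConst_pos g).le
      simp only [stableWeight]
      linarith
    · rw [Multiset.count_eq_zero.2 hmem]
      rw [Multiset.mem_cons, not_or] at hmem
      obtain ⟨k, rfl⟩ := Nat.exists_eq_succ_of_ne_zero (Ne.symm hmem.1)
      exact hv.le_of_count_zero hq (Multiset.count_eq_zero.2 hmem.2) hlower (ih.mono (by omega))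
        (by omega) (by omega)

end IsVirasoro

end StableBound

/-! ### Exponential growth rates -/

section GrowthRate

theorem factorial_mul_factorial_add_le (a i j : ℕ) :
    (a + i)! * (a + j)! ≤ a ! * (a + i + j)! :=
  calc (a + i)! * (a + j)! = (a + i)! * (a ! * (a + 1).ascFactorial j) := by
        rw [Nat.factorial_mul_ascFactorial]
    _ ≤ (a + i)! * (a ! * (a + i + 1).ascFactorial j) := by
        gcongr
        exact Nat.le_add_right a i
    _ = a ! * (a + i + j)! := by
        rw [mul_left_comm, Nat.factorial_mul_ascFactorial]

theorem pow_mul_factorial_mul_factorial_le (g : ℕ) :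
    (27 / 4 : ℝ) ^ (g + 1) * ((2 * g)! * (g + 1)!) ≤ 6 * (g + 2) * (3 * g + 1)! := by
  induction g with
  | zero => norm_num
  | succ g ih =>
    have hpoly : (27 / 4 : ℝ) * ((2 * g + 2) * (2 * g + 1) * (g + 2)) * (6 * (g + 2)) ≤
        6 * (g + 3) * ((3 * g + 4) * (3 * g + 3) * (3 * g + 2)) := by
      have : (0 : ℝ) ≤ g := g.cast_nonneg
      nlinarith [pow_nonneg this 2, pow_nonneg this 3]
    rw [show 2 * (g + 1) = 2 * g + 1 + 1 by ring,
      show 3 * (g + 1) + 1 = 3 * g + 1 + 1 + 1 + 1 by ring]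
    simp only [Nat.factorial_succ (2 * g + 1), Nat.factorial_succ (2 * g),
      Nat.factorial_succ (g + 1), Nat.factorial_succ (3 * g + 1 + 1 + 1),
      Nat.factorial_succ (3 * g + 1 + 1), Nat.factorial_succ (3 * g + 1)]
    push_cast
    calc _ = (27 / 4 : ℝ) * ((2 * g + 2) * (2 * g + 1) * (g + 2)) *
          ((27 / 4) ^ (g + 1) * ((2 * g)! * (g + 1)!)) := by ring
      _ ≤ (27 / 4 : ℝ) * ((2 * g + 2) * (2 * g + 1) * (g + 2)) *
          (6 * (g + 2) * (3 * g + 1)!) := by gcongr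
      _ = (27 / 4 : ℝ) * ((2 * g + 2) * (2 * g + 1) * (g + 2)) * (6 * (g + 2)) *
          (3 * g + 1)! := by ring
      _ ≤ 6 * (g + 3) * ((3 * g + 4) * (3 * g + 3) * (3 * g + 2)) * (3 * g + 1)! := by gcongr
      _ = _ := by ring

theorem genusConst_mul_factorial_le (g j : ℕ) :
    genusConst g * (2 * g + j)! ≤
      (g + 2) ^ 4 * ((1 / 3) ^ (g + 1) / (g + 1)!) * (2 * g + j + (g + 1))! := by
  have hshift : ((2 * g + j)! : ℝ) ≤ (2 * g)! * (2 * g + j + (g + 1))! / (3 * g + 1)! := by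
    rw [le_div_iff₀ (by positivity), show 3 * g + 1 = 2 * g + (g + 1) by ring]
    exact_mod_cast factorial_mul_factorial_add_le (2 * g) j (g + 1)
  have hcentral : (27 / 4 : ℝ) ^ (g + 1) * ((2 * g)! / (3 * g + 1)!) ≤ 6 * (g + 2) / (g + 1)! := by
    rw [le_div_iff₀ (by positivity), mul_div_assoc', div_mul_eq_mul_div,
      div_le_iff₀ (by positivity), mul_assoc]
    exact pow_mul_factorial_mul_factorial_le g
  set B := ((2 * g + j + (g + 1))! : ℝ)
  calc genusConst g * (2 * g + j)!
      ≤ (9 / 4) ^ g * (g + 1) ^ 3 / 24 * ((2 * g)! * B / (3 * g + 1)!) := by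
        unfold genusConst
        gcongr
    _ = (g + 1) ^ 3 / 54 * (1 / 3) ^ (g + 1) * B *
        ((27 / 4) ^ (g + 1) * ((2 * g)! / (3 * g + 1)!)) := by
        rw [show (9 / 4 : ℝ) = 27 / 4 * (1 / 3) by norm_num, mul_pow, pow_succ, pow_succ]
        ring
    _ ≤ (g + 1) ^ 3 / 54 * (1 / 3) ^ (g + 1) * B * (6 * (g + 2) / (g + 1)!) := by gcongr
    _ = (g + 1) ^ 3 * (g + 2) / 9 * ((1 / 3) ^ (g + 1) / (g + 1)!) * B := by ring
    _ ≤ (g + 2) ^ 3 * (g + 2) / 1 * ((1 / 3) ^ (g + 1) / (g + 1)!) * B := by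
        gcongr <;> norm_num
    _ = _ := by ring

/-- One term of the binomial expansion of `(r + (1 - r)) ^ (M + ℓ)`. -/
theorem factorial_add_mul_pow_div_le {r : ℝ} (h0 : 0 ≤ r) (h1 : r < 1) (M ℓ : ℕ) :
    ((M + ℓ)! : ℝ) * (r ^ ℓ / ℓ !) ≤ M ! * (1 - r)⁻¹ ^ M := by
  have hr : 0 < 1 - r := sub_pos.2 h1
  have hterm : r ^ ℓ * (1 - r) ^ M * (M + ℓ).choose ℓ ≤ 1 := by
    have hle := Finset.single_le_sum
      (f := fun m => r ^ m * (1 - r) ^ (M + ℓ - m) * ((M + ℓ).choose m : ℝ))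
      (fun i _ => by positivity) (Finset.mem_range.2 (show ℓ < M + ℓ + 1 by omega))
    rw [← add_pow, add_sub_cancel, one_pow] at hle
    simpa using hle
  have hchoose : ((M + ℓ)! : ℝ) = (M + ℓ).choose ℓ * M ! * ℓ ! := by
    exact_mod_cast (Nat.add_choose_mul_factorial_mul_factorial M ℓ).symm
  rw [inv_pow, ← div_eq_mul_inv, le_div_iff₀ (by positivity), hchoose]
  calc _ = M ! * (r ^ ℓ * (1 - r) ^ M * (M + ℓ).choose ℓ) := by field_simp
    _ ≤ (M ! : ℝ) * 1 := by gcongr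
    _ = M ! := mul_one _

theorem pow_le_max_pow_mul_min_pow {q : ℝ} (hq : 0 ≤ q) {N ℓ : ℕ} (h : ℓ ≤ N) :
    q ^ ℓ ≤ max (2 * q) 1 ^ N * min q (1 / 2) ^ ℓ := by
  have : 0 ≤ min q (1 / 2) := le_min hq (by norm_num)
  have hmul : q = max (2 * q) 1 * min q (1 / 2) := by
    rcases le_total q (1 / 2) with h | h
    · rw [max_eq_right (by linarith), min_eq_left h, one_mul]
    · rw [max_eq_left (by linarith), min_eq_right h]
      ring
  calc q ^ ℓ = max (2 * q) 1 ^ ℓ * min q (1 / 2) ^ ℓ := by rw [← mul_pow, ← hmul]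
    _ ≤ _ := by
      gcongr
      exact le_max_right _ _

theorem bddAbove_range_pow_mul_pow (d : ℕ) {r : ℝ} (h0 : 0 ≤ r) (h1 : r < 1) :
    BddAbove (Set.range fun n : ℕ => (n : ℝ) ^ d * r ^ n) :=
  (tendsto_pow_const_mul_const_pow_of_abs_lt_one d (by rwa [abs_of_nonneg h0])).bddAbove_range

/-- The exponential growth rate of the Virasoro amplitudes with `a = 5q/3`, up to a factor `3`. -/
def growthRate (q : ℝ) : ℝ := max (2 * q) 1 / (1 - min q (1 / 2))

/-- The constant in the bounds on the Virasoro amplitudes with `a = 5q/3`. -/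
def growthConst (q : ℝ) : ℝ :=
  27 + 108 * ⨆ n : ℕ, (n + 1 : ℝ) ^ 4 * (1 - min q (1 / 2)) ^ n

variable {q q' : ℝ}

theorem le_growthConst (hq : 0 < q) (n : ℕ) :
    27 + 108 * ((n + 1 : ℝ) ^ 4 * (1 - min q (1 / 2)) ^ n) ≤ growthConst q := by
  have hr : 0 < min q (1 / 2) := lt_min hq (by norm_num)
  have hr' : min q (1 / 2) ≤ 1 / 2 := min_le_right _ _
  unfold growthConst
  gcongr
  refine le_ciSup (f := fun n : ℕ => (n + 1 : ℝ) ^ 4 * (1 - min q (1 / 2)) ^ n) ?_ n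
  obtain ⟨K, hK⟩ := bddAbove_range_pow_mul_pow 4 (r := 1 - min q (1 / 2)) (by linarith)
    (by linarith)
  refine ⟨K / (1 - min q (1 / 2)), ?_⟩
  rintro _ ⟨n, rfl⟩
  rw [le_div_iff₀ (by linarith), mul_assoc, ← pow_succ]
  exact_mod_cast hK ⟨n + 1, rfl⟩

theorem twentySeven_le_growthConst (hq : 0 < q) : 27 ≤ growthConst q :=
  (le_add_of_nonneg_right (by
    have := min_le_right q (1 / 2)
    have : 0 ≤ 1 - min q (1 / 2) := by linarith
    positivity)).trans (le_growthConst hq 0)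

theorem growthRate_pos : 0 < growthRate q :=
  div_pos (lt_max_of_lt_right one_pos) (by linarith [min_le_right q (1 / 2)])

theorem growthFactor_le (hq : 0 ≤ q) (hq' : 0 < q') {ℓ N : ℕ} (h : ℓ ≤ N) (n M : ℕ) :
    growthFactor q n ℓ (M + ℓ) ≤ 3 ^ n * ((q / q') ^ ℓ *
      (growthRate q' ^ N * (1 - min q' (1 / 2)) ^ N * (M ! * (1 - min q' (1 / 2))⁻¹ ^ M))) := by
  set r := min q' (1 / 2) with hr
  have hr0 : 0 < r := lt_min hq' (by norm_num)
  have hr1 : r ≤ 1 / 2 := min_le_right _ _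
  have hpow := pow_le_max_pow_mul_min_pow hq'.le h
  rw [← mul_pow, growthRate, ← hr, div_mul_cancel₀ _ (by linarith)]
  calc growthFactor q n ℓ (M + ℓ)
      = 3 ^ n * ((q / q') ^ ℓ * (q' ^ ℓ * ((M + ℓ)! / ℓ !))) := by
        rw [growthFactor, ← mul_assoc ((q / q') ^ ℓ), ← mul_pow, div_mul_cancel₀ _ hq'.ne']
        ring
    _ ≤ 3 ^ n * ((q / q') ^ ℓ * (max (2 * q') 1 ^ N * r ^ ℓ * ((M + ℓ)! / ℓ !))) := by gcongr
    _ = 3 ^ n * ((q / q') ^ ℓ * (max (2 * q') 1 ^ N * ((M + ℓ)! * (r ^ ℓ / ℓ !)))) := by ring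
    _ ≤ _ := by
      have hfac := factorial_add_mul_pow_div_le hr0.le (show r < 1 by linarith) M ℓ
      exact mul_le_mul_of_nonneg_left (mul_le_mul_of_nonneg_left
        (mul_le_mul_of_nonneg_left hfac (by positivity)) (by positivity)) (by positivity)

theorem zeroFactor_le (g z : ℕ) : zeroFactor g z ≤ 4 :=
  calc zeroFactor g z ≤ (1 + 1 / (g + 1)) ^ 2 :=
        pow_le_pow_right₀ (le_add_of_nonneg_right (by positivity)) (min_le_right _ _)
    _ ≤ (1 + 1 / 1) ^ 2 := by
        gcongr
        exact le_add_of_nonneg_left g.cast_nonneg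
    _ = 4 := by norm_num

namespace IsVirasoro

variable {v : ℕ → ℕ → Multiset ℕ → ℝ}

theorem genus_zero_le (hq : 0 ≤ q) (hq' : 0 < q') (hv : IsVirasoro (5 * q / 3) v) {k ℓ N : ℕ}
    {s : Multiset ℕ} (hN : N = k + s.sum + ℓ) (hdim : N + 2 = s.card) :
    v 0 k s ≤ 27 * ((q / q') ^ ℓ * (3 * growthRate q') ^ N * N !) := by
  have hr : 0 < 1 - min q' (1 / 2) := by linarith [min_le_right q' (1 / 2)]
  have hzero : (5 / 6 : ℝ) ^ (k ::ₘ s).count 0 ≤ 1 := pow_le_one₀ (by norm_num) (by norm_num)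
  calc v 0 k s ≤ (5 / 6) ^ (k ::ₘ s).count 0 * growthFactor q (s.card + 1) ℓ (N + ℓ) :=
        hv.genus_zero_boundedBelow hq (s.card + ℓ + 1) k s ℓ (N + ℓ) (by omega) (by omega)
          (by omega)
    _ ≤ growthFactor q (s.card + 1) ℓ (N + ℓ) :=
        mul_le_of_le_one_left (growthFactor_nonneg hq _ _ _) hzero
    _ ≤ _ := growthFactor_le hq hq' (show ℓ ≤ N by omega) (s.card + 1) N
    _ = _ := by
        rw [← hdim, inv_pow, mul_pow]
        field_simp
        ring

theorem genus_succ_le (hq : 0 ≤ q) (hq' : 0 < q') (hv : IsVirasoro (5 * q / 3) v) {g k ℓ N : ℕ}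
    {s : Multiset ℕ} (hN : N = k + s.sum + ℓ) (hdim : N = 3 * g + 1 + s.card) :
    v (g + 1) k s ≤ 108 * ((g + 2) ^ 4 * (1 - min q' (1 / 2)) ^ (g + 1)) *
      ((q / q') ^ ℓ * (3 * growthRate q') ^ N * ((1 / 81) ^ (g + 1) * (N ! / (g + 1)!))) := by
  have hr : 0 < 1 - min q' (1 / 2) := by linarith [min_le_right q' (1 / 2)]
  have hR : 0 < growthRate q' := growthRate_pos
  have hC := (genusConst_pos g).le
  set M := 2 * g + s.card
  calc v (g + 1) k s
      ≤ genusConst g * zeroFactor g ((k ::ₘ s).count 0) *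
          growthFactor q (s.card + 1) ℓ (M + ℓ) :=
        hv.boundedBelow hq g (s.card + ℓ + 1) k s ℓ (M + ℓ) (by omega) (by omega) (by omega)
    _ ≤ genusConst g * 4 * (3 ^ (s.card + 1) * ((q / q') ^ ℓ * (growthRate q' ^ N *
          (1 - min q' (1 / 2)) ^ N * (M ! * (1 - min q' (1 / 2))⁻¹ ^ M)))) :=
        mul_le_mul (mul_le_mul_of_nonneg_left (zeroFactor_le _ _) hC)
          (growthFactor_le hq hq' (by omega) _ _) (growthFactor_nonneg hq _ _ _) (by positivity)
    _ = 4 * (3 ^ (s.card + 1) * (1 - min q' (1 / 2)) ^ (g + 1) * (q / q') ^ ℓ *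
          growthRate q' ^ N) * (genusConst g * M !) := by
        rw [show N = M + (g + 1) by omega, pow_add (1 - min q' (1 / 2)), inv_pow]
        field_simp
    _ ≤ 4 * (3 ^ (s.card + 1) * (1 - min q' (1 / 2)) ^ (g + 1) * (q / q') ^ ℓ *
          growthRate q' ^ N) * ((g + 2) ^ 4 * ((1 / 3) ^ (g + 1) / (g + 1)!) *
          (M + (g + 1))!) := by
        exact mul_le_mul_of_nonneg_left (genusConst_mul_factorial_le g s.card) (by positivity)
    _ = _ := by
        rw [show M + (g + 1) = N by omega, mul_pow, hdim,
          show (1 / 81 : ℝ) = 1 / 3 * (1 / 3 ^ 3) by norm_num]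
        simp only [mul_pow, div_pow, one_pow, ← pow_mul]
        field_simp
        ring

theorem le_growth (hq : 0 < q) (hq' : 0 < q') (hv : IsVirasoro (5 * q / 3) v) {g k ℓ N : ℕ}
    {s : Multiset ℕ} (hN : N = k + s.sum + ℓ) (hdim : N + 2 = 3 * g + s.card) :
    v g k s ≤ growthConst q' *
      ((q / q') ^ ℓ * (3 * growthRate q') ^ N * ((1 / 81) ^ g * (N ! / g !))) := by
  have hR : 0 < growthRate q' := growthRate_pos
  rcases g with - | g
  · refine (hv.genus_zero_le hq.le hq' hN (by omega)).trans ?_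
    simp only [pow_zero, Nat.factorial_zero, Nat.cast_one, div_one, one_mul]
    gcongr
    exact twentySeven_le_growthConst hq'
  · refine (hv.genus_succ_le hq.le hq' hN (by omega)).trans ?_
    gcongr
    have := le_growthConst hq' (g + 1)
    push_cast at this
    linarith

end IsVirasoro

end GrowthRate

/-! ### The coefficients of the Painlevé I curve -/

theorem ofPowerSeries_monomial {R : Type*} [Semiring R] (n : ℕ) (c : R) :
    HahnSeries.ofPowerSeries ℤ R (PowerSeries.monomial n c) = HahnSeries.single (n : ℤ) c := by
  rw [PowerSeries.monomial_eq_C_mul_X_pow, map_mul, HahnSeries.ofPowerSeries_C,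
    HahnSeries.ofPowerSeries_X_pow, HahnSeries.C_apply, HahnSeries.single_mul_single, zero_add,
    mul_one]

theorem residue_mul_single {K : Type*} [Field K] (f : LaurentSeries K) (d : ℤ) (c : K) :
    residue (f * HahnSeries.single d c) = f.coeff (-1 - d) * c :=
  HahnSeries.coeff_mul_single

theorem coeff_succ_primitive {K : Type*} [Field K] (f : PowerSeries K) (n : ℕ) :
    PowerSeries.coeff (n + 1) (primitive f) = PowerSeries.coeff n f / (n + 1 : K) := by
  simp [primitive]

theorem coeff_invUnitsSub_sq {R : Type*} [CommRing R] (a : Rˣ) (n : ℕ) :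
    PowerSeries.coeff n (invUnitsSub a ^ 2) = (n + 1) * (↑a⁻¹ : R) ^ (n + 2) := by
  have hterm : ∀ p ∈ antidiagonal n, PowerSeries.coeff p.1 (invUnitsSub a) *
      PowerSeries.coeff p.2 (invUnitsSub a) = (↑a⁻¹ : R) ^ (n + 2) := by
    intro p hp
    rw [PowerSeries.coeff_invUnitsSub, PowerSeries.coeff_invUnitsSub, one_divp, one_divp]
    norm_cast
    rw [← mem_antidiagonal.1 hp]
    group
  rw [sq, PowerSeries.coeff_mul, Finset.sum_congr rfl hterm]
  simp

namespace LocalSpectralCurve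

theorem derivative_x (S : LocalSpectralCurve) : derivative ℝ S.x = 2 * PowerSeries.X := by
  simp [x]

theorem derivative_e (j : ℕ) :
    derivative ℝ (e j) = PowerSeries.monomial (2 * j) ((2 * j + 1) / ((2 * j + 1)‼ : ℝ)) := by
  ext n
  rw [PowerSeries.coeff_derivative, e, PowerSeries.coeff_monomial, PowerSeries.coeff_monomial]
  by_cases h : n = 2 * j
  · rw [if_pos (by omega), if_pos h, h]
    push_cast
    ring
  · rw [if_neg (by omega), if_neg h, zero_mul]

end LocalSpectralCurve

/-- The coefficient of `X ^ j` in the geometric series `X ^ i / (1 - a X)`. -/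
def geomCoeff {R : Type*} [Semiring R] (a : R) (i j : ℕ) : R :=
  if i ≤ j then a ^ (j - i) else 0

section painleveI

variable {u : ℝ}

theorem evalNegHom_painleveI_y (u : ℝ) : evalNegHom (painleveI u).y = -(painleveI u).y := by
  ext n
  rw [evalNegHom, PowerSeries.coeff_rescale, map_neg]
  rcases n.even_or_odd with hn | hn
  · have h3 : n ≠ 3 := by rintro rfl; exact absurd hn (by decide)
    have h1 : n ≠ 1 := by rintro rfl; exact absurd hn (by decide)
    simp [painleveI, PowerSeries.coeff_X_pow, PowerSeries.coeff_C_mul, PowerSeries.coeff_X, h1, h3,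
      -map_mul]
  · rw [hn.neg_one_pow, neg_one_mul]

theorem theta_painleveI (hu : 3 * u ≠ 0) : (painleveI u).theta =
    HahnSeries.ofPowerSeries ℤ ℝ (PowerSeries.C (1 / 2) * expand 2 two_ne_zero
      (invUnitsSub (Units.mk0 (3 * u) hu))) * HahnSeries.single (-2) 1 := by
  set G := expand 2 two_ne_zero (invUnitsSub (Units.mk0 (3 * u) hu))
  have hG : G * (PowerSeries.C (3 * u) - PowerSeries.X ^ 2) = 1 := by
    have h := congrArg (expand 2 two_ne_zero)
      (PowerSeries.invUnitsSub_mul_sub (Units.mk0 (3 * u) hu))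
    rwa [map_mul, map_sub, map_one, PowerSeries.expand_C, PowerSeries.expand_X,
      Units.val_mk0] at h
  have hdenom : PowerSeries.C (1 / 2) * G * (((painleveI u).y - evalNegHom (painleveI u).y) *
      derivative ℝ (painleveI u).x) = -2 * PowerSeries.X ^ 2 := by
    have hhalf : PowerSeries.C (1 / 2 : ℝ) * 2 = 1 := by
      rw [← map_ofNat (PowerSeries.C (R := ℝ)) 2, ← map_mul]
      norm_num
    rw [evalNegHom_painleveI_y, LocalSpectralCurve.derivative_x, painleveI]
    linear_combination (-2 * PowerSeries.X ^ 2) * hG * (PowerSeries.C (1 / 2 : ℝ) * 2) +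
      (-2 * PowerSeries.X ^ 2) * hhalf
  have hmul := congrArg (HahnSeries.ofPowerSeries ℤ ℝ) hdenom
  rw [map_mul, map_mul (HahnSeries.ofPowerSeries ℤ ℝ) (-2), HahnSeries.ofPowerSeries_X_pow,
    map_neg, map_ofNat] at hmul
  have hX : HahnSeries.single (2 : ℤ) (1 : ℝ) * HahnSeries.single (-2) 1 = 1 := by
    simp
  rw [LocalSpectralCurve.theta, div_eq_iff]
  · linear_combination (-HahnSeries.single (-2 : ℤ) (1 : ℝ)) * hmul + 2 * hX
  · refine (map_ne_zero_iff _ HahnSeries.ofPowerSeries_injective).2 fun h => ?_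
    rw [h, mul_zero, ← map_ofNat (PowerSeries.C (R := ℝ)) 2, ← map_neg] at hdenom
    simpa [PowerSeries.coeff_C_mul_X_pow, -map_neg] using
      congrArg (PowerSeries.coeff 2) hdenom

theorem theta_coeff_painleveI (hu : u ≠ 0) (i j : ℕ) :
    (painleveI u).theta.coeff (2 * j - 2 * i - 2) = 1 / (6 * u) * geomCoeff (1 / (3 * u)) i j := by
  rw [theta_painleveI (by positivity), HahnSeries.coeff_mul_single, mul_one, geomCoeff]
  split_ifs with hij
  · have hindex : 2 * (j : ℤ) - 2 * i - 2 - -2 = (2 * (j - i) : ℕ) := by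
      rw [Nat.cast_mul, Nat.cast_sub hij]
      push_cast
      ring
    rw [hindex, HahnSeries.ofPowerSeries_apply_coeff, PowerSeries.coeff_C_mul,
      PowerSeries.coeff_expand_mul, PowerSeries.coeff_invUnitsSub, one_divp, ← inv_pow,
      Units.val_pow_eq_pow_val, Units.val_inv_eq_inv_val, Units.val_mk0]
    ring
  · rw [PowerSeries.coeff_coe, if_pos (by omega), mul_zero]

theorem omega02_painleveI (u : ℝ) : (painleveI u).omega02 =
    invUnitsSub (Units.mk0 (HahnSeries.single (1 : ℤ) (1 : ℝ)) (by simp)) ^ 2 := by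
  have hreg : (PowerSeries.mk fun n => HahnSeries.ofPowerSeries ℤ ℝ
      (PowerSeries.mk fun m => (painleveI u).reg m n)) = 0 := by
    ext n : 1
    rw [PowerSeries.coeff_mk, map_zero]
    exact map_zero _
  have hinv := PowerSeries.invUnitsSub_mul_sub
    (Units.mk0 (HahnSeries.single (1 : ℤ) (1 : ℝ)) (by simp))
  rw [Units.val_mk0] at hinv
  rw [LocalSpectralCurve.omega02, hreg, add_zero, eq_comm, PowerSeries.eq_inv_iff_mul_eq_one,
    ← mul_pow, hinv, one_pow]
  simp

theorem xi_painleveI (u : ℝ) (i : ℕ) : (painleveI u).xi i =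
    HahnSeries.single (-(2 * (i : ℤ) + 2)) ((2 * i + 1)‼ : ℝ) := by
  have : CharZero (LaurentSeries ℝ) :=
    charZero_of_injective_algebraMap (algebraMap ℝ (LaurentSeries ℝ)).injective
  have hne : ((2 * i : ℕ) + 1 : LaurentSeries ℝ) ≠ 0 := Nat.cast_add_one_ne_zero (2 * i)
  have hindex : -1 - (-(2 * (i : ℤ) + 2)) = (2 * i + 1 : ℕ) := by push_cast; ring
  rw [LocalSpectralCurve.xi, residue_mul_single, hindex, HahnSeries.ofPowerSeries_apply_coeff,
    coeff_succ_primitive, omega02_painleveI, coeff_invUnitsSub_sq, mul_div_cancel_left₀ _ hne,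
    Units.val_inv_eq_inv_val, Units.val_mk0, HahnSeries.inv_single, HahnSeries.single_pow,
    ← HahnSeries.single_zero_natCast, HahnSeries.single_mul_single]
  congr 1 <;> simp

theorem A_painleveI (hu : u ≠ 0) (i j k : ℕ) : (painleveI u).A i j k =
    if i = 0 ∧ j = 0 ∧ k = 0 then 1 / (6 * u) else 0 := by
  have hindex : -1 - ((2 * i + 1 + 2 * j + 2 * k : ℕ) : ℤ) =
      2 * (0 : ℕ) - 2 * (i + j + k : ℕ) - 2 := by
    push_cast
    ring
  rw [LocalSpectralCurve.A, LocalSpectralCurve.derivative_e, LocalSpectralCurve.derivative_e,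
    LocalSpectralCurve.e, PowerSeries.monomial_mul_monomial, PowerSeries.monomial_mul_monomial,
    ofPowerSeries_monomial, residue_mul_single, hindex, theta_coeff_painleveI hu, geomCoeff]
  split_ifs with hle hzero hzero
  · obtain ⟨rfl, rfl, rfl⟩ := hzero
    simp
  all_goals first | omega | simp

theorem B_painleveI (hu : u ≠ 0) (i j k : ℕ) : (painleveI u).B i j k =
    1 / (6 * u) * ((2 * j + 1) * (2 * k + 1)‼ / ((2 * i + 1)‼ * (2 * j + 1)‼)) *
      geomCoeff (1 / (3 * u)) (i + j) (k + 1) := by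
  have hindex : -1 - (((2 * i + 1 + 2 * j : ℕ) : ℤ) + -(2 * (k : ℤ) + 2)) =
      2 * (k + 1 : ℕ) - 2 * (i + j : ℕ) - 2 := by
    push_cast
    ring
  rw [LocalSpectralCurve.B, LocalSpectralCurve.derivative_e, LocalSpectralCurve.e,
    PowerSeries.monomial_mul_monomial, ofPowerSeries_monomial, xi_painleveI, mul_assoc,
    HahnSeries.single_mul_single, residue_mul_single, hindex, theta_coeff_painleveI hu]
  ring

theorem C_painleveI (hu : u ≠ 0) (i j k : ℕ) : (painleveI u).C i j k =
    1 / (6 * u) * ((2 * j + 1)‼ * (2 * k + 1)‼ / (2 * i + 1)‼) *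
      geomCoeff (1 / (3 * u)) i (j + k + 2) := by
  have hindex : -1 - (((2 * i + 1 : ℕ) : ℤ) + (-(2 * (j : ℤ) + 2) + -(2 * (k : ℤ) + 2))) =
      2 * (j + k + 2 : ℕ) - 2 * i - 2 := by
    push_cast
    ring
  rw [LocalSpectralCurve.C, LocalSpectralCurve.e, ofPowerSeries_monomial, xi_painleveI,
    xi_painleveI, mul_assoc, mul_assoc, HahnSeries.single_mul_single, HahnSeries.single_mul_single,
    residue_mul_single, hindex, theta_coeff_painleveI hu]
  ring

theorem D_painleveI (hu : u ≠ 0) (i : ℕ) : (painleveI u).D i =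
    1 / (6 * u) * (1 / (2 * i + 1)‼) * (geomCoeff (1 / (3 * u)) i 1 / 8) := by
  have hphi : (painleveI u).phiCoeff 0 0 = 0 := rfl
  have htheta : ∀ m, (painleveI u).thetaCoeff m =
      1 / (6 * u) * geomCoeff (1 / (3 * u)) 0 m := fun m => by
    simpa [LocalSpectralCurve.thetaCoeff] using theta_coeff_painleveI hu 0 m
  rw [LocalSpectralCurve.D, hphi, htheta, htheta]
  rcases i with _ | _ | i
  · simp [geomCoeff]
    ring
  · simp [geomCoeff, Nat.doubleFactorial]
    ring
  · simp [geomCoeff]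

end painleveI

/-! ### The amplitudes as functions of a multiset -/

section Amplitudes

theorem sum_get_eraseIdx {α R : Type*} [DecidableEq α] [CommRing R]
    (ψ : α → Multiset α → R) (L : List α) :
    ∑ m : Fin L.length, ψ (L.get m) (L.eraseIdx m) = removeSum ψ L := by
  rw [removeSum_apply, Multiset.map_coe, Multiset.sum_coe, ← Fin.sum_univ_fun_getElem]
  refine Finset.sum_congr rfl fun m _ => ?_
  have hperm : ((L[m] :: L.eraseIdx m : List α) : Multiset α) = L :=
    Multiset.coe_eq_coe.2 (List.getElem_cons_eraseIdx_perm m.isLt)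
  have herase : (L.eraseIdx m : Multiset α) = (L : Multiset α).erase L[m] := by
    rw [← hperm, ← Multiset.cons_coe, Multiset.erase_cons_head]
  rw [herase]
  rfl

theorem sum_powerset_mul_sdiff {ι α R : Type*} [DecidableEq ι] [CommRing R]
    (χ ψ : Multiset α → R) (f : ι → α) (T : Finset ι) :
    ∑ I ∈ T.powerset, χ (I.val.map f) * ψ ((T \ I).val.map f) = conv χ ψ (T.val.map f) := by
  induction T using Finset.induction_on generalizing χ ψ with
  | empty => simp
  | insert x T hx ih =>
    have hleft : ∀ I ∈ T.powerset, χ ((insert x I).val.map f) *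
        ψ ((insert x T \ insert x I).val.map f) =
          pderiv (f x) χ (I.val.map f) * ψ ((T \ I).val.map f) := fun I hI => by
      have hxI : x ∉ I := fun h => hx (Finset.mem_powerset.1 hI h)
      rw [Finset.insert_val_of_notMem hxI, Multiset.map_cons, Finset.insert_sdiff_insert,
        Finset.sdiff_insert_of_notMem hx, pderiv_apply]
    have hright : ∀ I ∈ T.powerset, χ (I.val.map f) * ψ ((insert x T \ I).val.map f) =
        χ (I.val.map f) * pderiv (f x) ψ ((T \ I).val.map f) := fun I hI => by
      have hxI : x ∉ I := fun h => hx (Finset.mem_powerset.1 hI h)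
      rw [Finset.insert_sdiff_of_notMem _ hxI, Finset.insert_val_of_notMem (by simp [hx]),
        Multiset.map_cons, pderiv_apply]
    rw [Finset.sum_powerset_insert hx, Finset.sum_congr rfl hleft, Finset.sum_congr rfl hright, ih,
      ih, Finset.insert_val_of_notMem hx, Multiset.map_cons, ← pderiv_apply (f x) (conv χ ψ),
      pderiv_conv, Pi.add_apply, add_comm]

theorem coe_sublistAt (L : List ℕ) (I : Finset (Fin L.length)) :
    (sublistAt L I : Multiset ℕ) = I.val.map L.get := by
  have hI : I = Finset.univ.filter (· ∈ I) := by
    ext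
    simp
  rw [sublistAt, ← Multiset.map_coe, ← Multiset.filter_coe]
  conv_rhs => rw [hI]
  rfl

theorem sum_sublistAt {R : Type*} [CommRing R] (χ ψ : Multiset ℕ → R) (L : List ℕ) :
    ∑ I : Finset (Fin L.length), χ (sublistAt L I) * ψ (sublistAt L Iᶜ) = conv χ ψ L := by
  have huniv : (Finset.univ : Finset (Fin L.length)).val.map L.get = (L : Multiset ℕ) := by
    rw [← coe_sublistAt]
    simp [sublistAt]
  simp only [coe_sublistAt, Finset.compl_eq_univ_sdiff]
  rw [← Finset.powerset_univ, sum_powerset_mul_sdiff, huniv]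

namespace LocalSpectralCurve

variable (S : LocalSpectralCurve)

theorem A_comm (i j k : ℕ) : S.A i j k = S.A i k j := by
  rw [A, A, mul_right_comm]

end LocalSpectralCurve

variable (S : LocalSpectralCurve)

/-- The amplitude `F_{g; k, s}` of a local spectral curve with a distinguished index `k` and the
others collected in a multiset `s`; compare `airyAmplitude_eq_airyM`. -/
def airyM (g k : ℕ) (s : Multiset ℕ) : ℝ :=
  airyAmplitude S g (k :: s.toList)

/-- The sum over `B` and `C` in the recursion of the amplitudes. -/
def airyStep (g k : ℕ) (s : Multiset ℕ) : ℝ :=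
  removeSum (fun x t => ∑ᶠ μ : ℕ, S.B k x μ * airyM S g μ t) s +
    1 / 2 * ∑ᶠ p : ℕ × ℕ, S.C k p.1 p.2 *
      (virLoop (airyM S) g p s + virSplit (airyM S) (airyM S) g p s)

theorem airyM_zero_of_card_le_one (k : ℕ) {s : Multiset ℕ} (hs : s.card ≤ 1) :
    airyM S 0 k s = 0 := by
  rw [airyM, airyAmplitude, if_pos ⟨rfl, by simpa using hs⟩]

theorem virLoop_airyM_eq_zero {g : ℕ} {s : Multiset ℕ} (h : 2 * g + s.card ≤ 2) (p : ℕ × ℕ) :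
    virLoop (airyM S) g p s = 0 := by
  rcases g with _ | g
  · rfl
  · obtain rfl : g = 0 := by omega
    exact airyM_zero_of_card_le_one S _ (by rw [Multiset.card_cons]; omega)

theorem virSplit_airyM_eq_zero {g : ℕ} {s : Multiset ℕ} (h : 2 * g + s.card ≤ 2) (p : ℕ × ℕ) :
    virSplit (airyM S) (airyM S) g p s = 0 := by
  refine virSplit_apply_eq_zero (fun g' k t ht => ?_)
    (fun k => airyM_zero_of_card_le_one S k (by simp)) p
  obtain rfl : g' = 0 := by omega
  exact airyM_zero_of_card_le_one S k (by omega)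

theorem airyStep_eq_zero {g : ℕ} (k : ℕ) {s : Multiset ℕ} (h : 2 * g + s.card ≤ 2) :
    airyStep S g k s = 0 := by
  have hmerge : removeSum (fun x t => ∑ᶠ μ : ℕ, S.B k x μ * airyM S g μ t) s = 0 := by
    refine removeSum_apply_eq_zero fun x hx => ?_
    have hcard := Multiset.card_erase_add_one hx
    obtain rfl : g = 0 := by omega
    simp [airyM_zero_of_card_le_one S _ (show (s.erase x).card ≤ 1 by omega)]
  simp [airyStep, hmerge, virLoop_airyM_eq_zero S h, virSplit_airyM_eq_zero S h]

theorem airyAmplitude_cons_of_lt {g a : ℕ} {L : List ℕ} (h : 2 < 2 * g + L.length)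
    (ih : ∀ g' a' L', 2 * g' + L'.length < 2 * g + L.length →
      airyAmplitude S g' (a' :: L') = airyM S g' a' L') :
    airyAmplitude S g (a :: L) = airyStep S g a L := by
  rw [airyAmplitude, if_neg (by omega), if_neg (by omega), if_neg (by omega), airyStep]
  congr 1
  · rw [← sum_get_eraseIdx]
    refine Finset.sum_congr rfl fun m _ => finsum_congr fun μ => ?_
    have hm := m.isLt
    rw [ih _ _ _ (by simp only [List.length_eraseIdx, hm, if_true]; omega)]
  · congr 1
    refine finsum_congr fun p => ?_
    congr 2
    · rcases g with _ | g
      · simp [virLoop]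
      · simp only [le_add_iff_nonneg_left, zero_le, ↓reduceDIte, Nat.add_sub_cancel]
        rw [ih _ _ _ (by rw [List.length_cons]; omega), ← Multiset.cons_coe]
        rfl
    · rw [virSplit, Finset.sum_apply, Finset.Nat.sum_antidiagonal_eq_sum_range_succ
        (fun i j => conv (airyM S i p.1) (airyM S j p.2) L), ← Fin.sum_univ_eq_sum_range
        (fun i => conv (airyM S i p.1) (airyM S (g - i) p.2) L)]
      refine Finset.sum_congr rfl fun i _ => ?_
      rw [← sum_sublistAt]
      refine Finset.sum_congr rfl fun I _ => ?_
      have hi := i.isLt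
      have hI := Finset.card_add_card_compl I
      rw [Fintype.card_fin] at hI
      have hlen := length_sublistAt L I
      have hlen' := length_sublistAt L Iᶜ
      split_ifs with hstable
      · rw [ih _ _ _ (by omega), ih _ _ _ (by omega)]
      · by_cases hi0 : (i : ℕ) = 0 ∧ I.card = 0
        · rw [hi0.1, airyM_zero_of_card_le_one S p.1 (by rw [Multiset.coe_card]; omega), zero_mul]
        · rw [show g - (i : ℕ) = 0 by omega,
            airyM_zero_of_card_le_one S p.2 (by rw [Multiset.coe_card]; omega), mul_zero]

theorem airyAmplitude_pair (a x y : ℕ) : airyAmplitude S 0 [a, x, y] = S.A a x y := by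
  rw [airyAmplitude, if_neg (by simp), if_pos (by simp)]
  rfl

theorem airyAmplitude_eq_airyM (g a : ℕ) (L : List ℕ) :
    airyAmplitude S g (a :: L) = airyM S g a L := by
  induction hn : 2 * g + L.length using Nat.strong_induction_on generalizing g a L with
  | _ n IH =>
  have ih : ∀ g' a' L', 2 * g' + L'.length < 2 * g + L.length →
      airyAmplitude S g' (a' :: L') = airyM S g' a' L' :=
    fun g' a' L' h => IH _ (hn ▸ h) g' a' L' rfl
  have hperm : (L : Multiset ℕ).toList.Perm L := Multiset.coe_eq_coe.1 (Multiset.coe_toList _)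
  rw [airyM]
  by_cases h : 2 < 2 * g + L.length
  · rw [airyAmplitude_cons_of_lt S h ih, airyAmplitude_cons_of_lt S (hperm.length_eq ▸ h)
      fun g' a' L' h' => ih g' a' L' (hperm.length_eq ▸ h'), Multiset.coe_toList]
  · generalize (L : Multiset ℕ).toList = M at hperm
    rcases L with _ | ⟨x, _ | ⟨y, _ | ⟨z, L⟩⟩⟩
    · rw [List.perm_nil.1 hperm]
    · rw [List.perm_singleton.1 hperm]
    · obtain rfl : g = 0 := by
        simp only [List.length_cons] at h
        omega
      rcases List.perm_pair.1 hperm with rfl | rfl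
      · rfl
      · rw [airyAmplitude_pair, airyAmplitude_pair, S.A_comm]
    · simp only [List.length_cons] at h
      omega

variable {u : ℝ}

/-- The initial values of the amplitudes of the Painlevé I curve. -/
def painleveInit (u : ℝ) (g k : ℕ) : Multiset ℕ → ℝ :=
  (if g = 0 ∧ k = 0 then Pi.single {0, 0} (1 / (6 * u)) else 0) +
    if g = 1 then Pi.single 0 ((painleveI u).D k) else 0

theorem painleveInit_apply_eq_zero (g k : ℕ) {s : Multiset ℕ} (h : 2 < 2 * g + s.card) :
    painleveInit u g k s = 0 := by
  have hpair : g = 0 → s ≠ {0, 0} := by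
    rintro rfl rfl
    simp at h
  have hempty : g = 1 → s ≠ 0 := by
    rintro rfl rfl
    simp at h
  rcases g with _ | _ | g
  · by_cases hk : k = 0 <;> simp [painleveInit, hk, hpair rfl, -Multiset.insert_eq_cons]
  · simp [painleveInit, hempty rfl]
  · simp [painleveInit]

theorem airyM_painleveI_eq (hu : u ≠ 0) (g k : ℕ) (s : Multiset ℕ) :
    airyM (painleveI u) g k s = airyStep (painleveI u) g k s + painleveInit u g k s := by
  by_cases h : 2 < 2 * g + s.card
  · rw [painleveInit_apply_eq_zero g k h, add_zero, airyM, airyAmplitude_cons_of_lt _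
      (by simpa using h) fun g' a' L' _ => airyAmplitude_eq_airyM _ g' a' L', Multiset.coe_toList]
  rw [airyStep_eq_zero _ _ (by omega), zero_add]
  obtain ⟨rfl, hs⟩ | ⟨rfl, hs⟩ | ⟨rfl, rfl⟩ : g = 0 ∧ s.card ≤ 1 ∨ g = 0 ∧ s.card = 2 ∨
      g = 1 ∧ s = 0 := by
    rw [← Multiset.card_eq_zero]
    omega
  · have hpair : s ≠ {0, 0} := by
      rintro rfl
      simp at hs
    by_cases hk : k = 0 <;>
      simp [airyM_zero_of_card_le_one _ _ hs, painleveInit, hk, hpair, -Multiset.insert_eq_cons]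
  · obtain ⟨x, y, rfl⟩ := Multiset.card_eq_two.1 hs
    have hxy : ({x, y} : Multiset ℕ) = {0, 0} ↔ x = 0 ∧ y = 0 :=
      ⟨fun h => by simpa using congrArg Multiset.sum h, fun h => by rw [h.1, h.2]⟩
    have hpair := airyAmplitude_eq_airyM (painleveI u) 0 k [x, y]
    rw [airyAmplitude_pair, A_painleveI hu] at hpair
    refine hpair.symm.trans ?_
    by_cases hk : k = 0 <;>
      simp [painleveInit, hk, Pi.single_apply, hxy, -Multiset.insert_eq_cons]
  · rw [airyM, Multiset.toList_zero, airyAmplitude, if_neg (by simp), if_neg (by simp),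
      if_pos (by simp)]
    simp [painleveInit]

end Amplitudes

/-! ### The resolved form of the Virasoro recursion -/

section Resolved

variable {K : Type*} [Field K]

theorem geomCoeff_eq_add (a : K) (i j : ℕ) :
    geomCoeff a i j = (if i = j then 1 else 0) + a * geomCoeff a (i + 1) j := by
  rcases lt_trichotomy i j with h | rfl | h
  · simp [geomCoeff, h.le, h.ne, Nat.succ_le_of_lt h, ← pow_succ',
      show j - (i + 1) + 1 = j - i by omega]
  · simp [geomCoeff]
  · simp [geomCoeff, h.not_ge, h.ne', show ¬ i + 1 ≤ j by omega]

theorem finsum_geomCoeff_mul {ι : Type*} (a : K) (m : ℕ) (n : ι → ℕ) {f : ι → K}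
    (hf : f.support.Finite) : ∑ᶠ i, geomCoeff a m (n i) * f i =
      ∑ᶠ i, (if m = n i then f i else 0) + a * ∑ᶠ i, geomCoeff a (m + 1) (n i) * f i := by
  rw [mul_finsum, ← finsum_add_distrib]
  · refine finsum_congr fun i => ?_
    rw [geomCoeff_eq_add, add_mul, ite_mul, one_mul, zero_mul, mul_assoc]
  · exact hf.subset fun i hi h => hi (by simp [h])
  · exact hf.subset fun i hi h => hi (by simp [h])

/-- The resolved form of `virMerge`: eliminating the shift term `a • v g (k + 1)` of the Virasoro
recursion by iteration sums a geometric series in `a`. -/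
def geomMerge (a : K) (w : ℕ → Multiset ℕ → K) (k x : ℕ) (t : Multiset ℕ) : K :=
  (2 * x + 1) * ∑ᶠ μ, geomCoeff a (k + x) (μ + 1) * w μ t

/-- The resolved form of `virQuad`, see `geomMerge`. -/
def geomQuad (a : K) (v : ℕ → ℕ → Multiset ℕ → K) (g k : ℕ) (s : Multiset ℕ) : K :=
  1 / 2 * ∑ᶠ p : ℕ × ℕ, geomCoeff a k (p.1 + p.2 + 2) * (virLoop v g p s + virSplit v v g p s)

/-- The resolved form of `virInit`, see `geomMerge`. -/
def geomInit (a : K) (g k : ℕ) : Multiset ℕ → K :=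
  (if g = 0 then Pi.single {0, 0} (geomCoeff a k 0) else 0) +
    if g = 1 then Pi.single 0 (geomCoeff a k 1 / 8) else 0

theorem geomMerge_eq_add (a : K) {w : ℕ → Multiset ℕ → K} {t : Multiset ℕ}
    (hw : (Function.support fun μ => w μ t).Finite) (k x : ℕ) :
    geomMerge a w k x t = virMerge w k x t + a * geomMerge a w (k + 1) x t := by
  have hdelta : ∑ᶠ μ, (if k + x = μ + 1 then w μ t else 0) =
      if k + x = 0 then 0 else w (k + x - 1) t := by
    split_ifs with h
    · simp [h]
    · rw [finsum_eq_single _ (k + x - 1) fun μ hμ => if_neg (by omega), if_pos (by omega)]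
  rw [geomMerge, finsum_geomCoeff_mul a _ _ hw, hdelta, geomMerge, virMerge,
    show k + 1 + x = k + x + 1 by omega]
  split_ifs <;> simp <;> ring

theorem geomQuad_eq_add (a : K) {v : ℕ → ℕ → Multiset ℕ → K} {g : ℕ} {s : Multiset ℕ}
    (hv : (Function.support fun p => virLoop v g p s + virSplit v v g p s).Finite) (k : ℕ) :
    geomQuad a v g k s = virQuad v g k s + a * geomQuad a v g (k + 1) s := by
  have hdelta : 1 / 2 * ∑ᶠ p : ℕ × ℕ,
      (if k = p.1 + p.2 + 2 then virLoop v g p s + virSplit v v g p s else 0) =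
        virQuad v g k s := by
    rcases k with _ | _ | k
    · simp [virQuad]
    · rw [finsum_eq_zero_of_forall_eq_zero fun p => if_neg (by omega)]
      simp [virQuad]
    · rw [finsum_eq_finsetSum_of_support_subset (s := antidiagonal k) _ fun p hp => by
        simpa [eq_comm] using (Function.mem_support.1 hp |> ite_ne_right_iff.1).1]
      simp only [virQuad, Pi.smul_apply, Finset.sum_apply, Pi.add_apply, smul_eq_mul]
      congr 1
      refine Finset.sum_congr rfl fun p hp => if_pos ?_
      rw [mem_antidiagonal.1 hp]
  rw [geomQuad, finsum_geomCoeff_mul a _ _ hv, mul_add, hdelta, geomQuad, mul_left_comm]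

theorem geomInit_eq_add (a : K) (g k : ℕ) :
    geomInit a g k = virInit g k + a • geomInit a g (k + 1) := by
  rcases g with _ | _ | g
  · cases k <;> simp [geomInit, virInit, geomCoeff]
  · rcases k with _ | _ | k <;>
      simp [geomInit, virInit, geomCoeff, ← Pi.single_smul, div_eq_mul_inv]
  · simp [geomInit, virInit]

theorem geomInit_apply_eq_zero (a : K) {g k : ℕ} {s : Multiset ℕ}
    (h : 3 * g + s.card < k + s.sum + 2) : geomInit a g k s = 0 := by
  rcases g with _ | _ | g
  · rcases eq_or_ne s {0, 0} with rfl | hs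
    · have hk : ¬ k ≤ 0 := by
        simp at h
        omega
      simp [geomInit, geomCoeff, hk]
    · simp [geomInit, hs, -Multiset.insert_eq_cons]
  · rcases eq_or_ne s 0 with rfl | hs
    · have hk : ¬ k ≤ 1 := by
        simp at h
        omega
      simp [geomInit, geomCoeff, hk]
    · simp [geomInit, hs]
  · simp [geomInit]

/-- The form of `IsVirasoro` in which the shift term has been eliminated, see `geomMerge`. -/
structure IsResolvedVirasoro (a : K) (v : ℕ → ℕ → Multiset ℕ → K) : Prop where
  unstable : ∀ k s, s.card ≤ 1 → v 0 k s = 0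
  rec_eq : ∀ g k s, v g k s =
    removeSum (geomMerge a (v g) k) s + geomQuad a v g k s + geomInit a g k s

namespace IsResolvedVirasoro

variable {a : K} {v : ℕ → ℕ → Multiset ℕ → K} (hv : IsResolvedVirasoro a v)
include hv

theorem virLoop_add_virSplit_eq_zero {g : ℕ} {s : Multiset ℕ}
    (hvanish : ∀ g' k t, 2 * g' + t.card < 2 * g + s.card → 3 * g' + t.card < k + t.sum + 2 →
      v g' k t = 0)
    {p : ℕ × ℕ} (hp : 3 * g + s.card < p.1 + p.2 + s.sum + 4) :
    virLoop v g p s + virSplit v v g p s = 0 := by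
  have hloop : virLoop v g p s = 0 := by
    rcases g with _ | g
    · rfl
    · refine hvanish _ _ _ ?_ ?_ <;> simp only [Multiset.card_cons, Multiset.sum_cons] <;> omega
  rw [hloop, zero_add, virSplit, Finset.sum_apply]
  refine Finset.sum_eq_zero fun h hh => conv_apply_eq_zero fun t₁ t₂ ht => ?_
  have hgenus := mem_antidiagonal.1 hh
  have hcard := congrArg Multiset.card ht
  have hsum := congrArg Multiset.sum ht
  rw [Multiset.card_add] at hcard
  rw [Multiset.sum_add] at hsum
  rw [mul_eq_zero]
  by_cases h₁ : h.1 = 0 ∧ t₁.card ≤ 1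
  · exact Or.inl (h₁.1 ▸ hv.unstable _ _ h₁.2)
  by_cases h₂ : h.2 = 0 ∧ t₂.card ≤ 1
  · exact Or.inr (h₂.1 ▸ hv.unstable _ _ h₂.2)
  by_cases hdim : 3 * h.1 + t₁.card < p.1 + t₁.sum + 2
  · exact Or.inl (hvanish _ _ _ (by omega) hdim)
  · exact Or.inr (hvanish _ _ _ (by omega) (by omega))

theorem vanish (g k : ℕ) (s : Multiset ℕ) (h : 3 * g + s.card < k + s.sum + 2) :
    v g k s = 0 := by
  induction hn : 2 * g + s.card using Nat.strong_induction_on generalizing g k s with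
  | _ n IH =>
  have ih : ∀ g' k t, 2 * g' + t.card < 2 * g + s.card → 3 * g' + t.card < k + t.sum + 2 →
      v g' k t = 0 := fun g' k t hlt hdim => IH _ (hn ▸ hlt) g' k t hdim rfl
  have hmerge : removeSum (geomMerge a (v g) k) s = 0 := by
    refine removeSum_apply_eq_zero fun x hx => ?_
    have hcard := Multiset.card_erase_add_one hx
    have hsum := Multiset.sum_erase hx
    rw [geomMerge, finsum_eq_zero_of_forall_eq_zero fun μ => ?_, mul_zero]
    by_cases hμ : k + x ≤ μ + 1
    · rw [ih _ _ _ (by omega) (by omega), mul_zero]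
    · rw [geomCoeff, if_neg hμ, zero_mul]
  have hquad : geomQuad a v g k s = 0 := by
    rw [geomQuad, finsum_eq_zero_of_forall_eq_zero fun p => ?_, mul_zero]
    by_cases hp : k ≤ p.1 + p.2 + 2
    · rw [hv.virLoop_add_virSplit_eq_zero ih (by omega), mul_zero]
    · rw [geomCoeff, if_neg hp, zero_mul]
  rw [hv.rec_eq, hmerge, hquad, geomInit_apply_eq_zero a h, add_zero, add_zero]

theorem isVirasoro : IsVirasoro a v where
  vanish := hv.vanish
  rec_eq g k := by
    ext s
    have hmerge : removeSum (geomMerge a (v g) k) s = removeSum (virMerge (v g) k) s +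
        a * removeSum (geomMerge a (v g) (k + 1)) s := by
      have hfinite : ∀ t, (Function.support fun μ => v g μ t).Finite := fun t =>
        (Set.finite_le_nat (3 * g + t.card)).subset fun μ hμ => by
          by_contra hlt
          exact hμ (hv.vanish _ _ _ (by simp at hlt; omega))
      rw [← smul_eq_mul, ← Pi.smul_apply, ← map_smul, ← Pi.add_apply, ← map_add]
      refine congrFun (congrArg removeSum ?_) s
      ext x t
      exact geomMerge_eq_add a (hfinite t) k x
    have hquad : geomQuad a v g k s = virQuad v g k s + a * geomQuad a v g (k + 1) s := by
      refine geomQuad_eq_add a (Set.Finite.subset ((Set.finite_le_nat (3 * g + s.card)).prod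
        (Set.finite_le_nat (3 * g + s.card))) fun p hp => ?_) k
      by_contra hlt
      refine hp (hv.virLoop_add_virSplit_eq_zero (fun g' k t _ => hv.vanish g' k t) ?_)
      simp at hlt
      omega
    have hinit := congrFun (geomInit_eq_add a g k) s
    simp only [Pi.add_apply, Pi.smul_apply, smul_eq_mul] at hinit ⊢
    rw [hv.rec_eq g k, hv.rec_eq g (k + 1), hmerge, hquad, hinit]
    ring

end IsResolvedVirasoro

end Resolved

/-! ### The normalised amplitudes of the Painlevé I curve -/

section NormAmp

/-- The product of the odd double factorials `(2x+1)!!` over the entries of a multiset. -/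
def oddProd (s : Multiset ℕ) : ℝ :=
  (s.map fun x => ((2 * x + 1)‼ : ℝ)).prod

theorem oddProd_cons (x : ℕ) (s : Multiset ℕ) :
    oddProd (x ::ₘ s) = (2 * x + 1)‼ * oddProd s := by
  rw [oddProd, Multiset.map_cons, Multiset.prod_cons, oddProd]

theorem oddProd_add (s t : Multiset ℕ) : oddProd (s + t) = oddProd s * oddProd t := by
  rw [oddProd, Multiset.map_add, Multiset.prod_add, oddProd, oddProd]

theorem oddProd_pos (s : Multiset ℕ) : 0 < oddProd s := by
  induction s using Multiset.induction with
  | empty => simp [oddProd]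
  | cons x s ih =>
    rw [oddProd_cons]
    positivity

/-- The factor by which `F_{g; k, s} (2k+1)!!` has to be multiplied in order to satisfy the
Virasoro recursion. -/
def normWeight (u : ℝ) (g : ℕ) (s : Multiset ℕ) : ℝ :=
  oddProd s * ((6 * u) ^ (2 * g + s.card) / (6 * u))

/-- The amplitudes of the Painlevé I curve in the normalisation of `IsVirasoro`. -/
def normAmp (u : ℝ) (g k : ℕ) (s : Multiset ℕ) : ℝ :=
  (2 * k + 1)‼ * airyM (painleveI u) g k s * normWeight u g s

variable {u : ℝ}

theorem normWeight_cons (g x : ℕ) (s : Multiset ℕ) :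
    normWeight u g (x ::ₘ s) = 6 * u * ((2 * x + 1)‼ * normWeight u g s) := by
  rw [normWeight, oddProd_cons, Multiset.card_cons, normWeight, ← add_assoc, pow_succ]
  ring

theorem normWeight_mul_normWeight (g₁ g₂ : ℕ) (s t : Multiset ℕ) :
    normWeight u g₁ s * normWeight u g₂ t = 1 / (6 * u) * normWeight u (g₁ + g₂) (s + t) := by
  rw [normWeight, normWeight, normWeight, oddProd_add, Multiset.card_add,
    show 2 * (g₁ + g₂) + (s.card + t.card) = 2 * g₁ + s.card + (2 * g₂ + t.card) by ring, pow_add]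
  ring

theorem virSplit_normAmp (g : ℕ) (p : ℕ × ℕ) (s : Multiset ℕ) :
    virSplit (normAmp u) (normAmp u) g p s =
      1 / (6 * u) * ((2 * p.1 + 1)‼ * (2 * p.2 + 1)‼) * normWeight u g s *
        virSplit (airyM (painleveI u)) (airyM (painleveI u)) g p s := by
  rw [virSplit, virSplit, Finset.sum_apply, Finset.sum_apply, Finset.mul_sum]
  refine Finset.sum_congr rfl fun h hh => conv_apply_eq_mul fun t₁ t₂ ht => ?_
  rw [← mem_antidiagonal.1 hh, ← ht, normAmp, normAmp]
  linear_combination (2 * p.1 + 1)‼ * (2 * p.2 + 1)‼ * airyM (painleveI u) h.1 p.1 t₁ *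
    airyM (painleveI u) h.2 p.2 t₂ * normWeight_mul_normWeight (u := u) h.1 h.2 t₁ t₂

variable (hu : u ≠ 0)
include hu

theorem normWeight_succ_cons (g x : ℕ) (s : Multiset ℕ) :
    normWeight u g (x ::ₘ s) = 1 / (6 * u) * ((2 * x + 1)‼ * normWeight u (g + 1) s) := by
  rw [normWeight_cons, normWeight, normWeight, mul_add_one, add_right_comm,
    pow_add _ (2 * g + s.card) 2]
  field_simp

theorem virLoop_normAmp (g : ℕ) (p : ℕ × ℕ) (s : Multiset ℕ) : virLoop (normAmp u) g p s =
    1 / (6 * u) * ((2 * p.1 + 1)‼ * (2 * p.2 + 1)‼) * normWeight u g s *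
      virLoop (airyM (painleveI u)) g p s := by
  rcases g with _ | g
  · simp [virLoop]
  · rw [virLoop, virLoop, pderiv_apply, pderiv_apply, normAmp, normWeight_succ_cons hu]
    ring

theorem geomMerge_normAmp (g k x : ℕ) (t : Multiset ℕ) :
    geomMerge (1 / (3 * u)) (normAmp u g) k x t = (2 * k + 1)‼ * normWeight u g (x ::ₘ t) *
      ∑ᶠ μ, (painleveI u).B k x μ * airyM (painleveI u) g μ t := by
  rw [geomMerge, mul_finsum, mul_finsum]
  refine finsum_congr fun μ => ?_
  have hk : ((2 * k + 1)‼ : ℝ) ≠ 0 := by positivity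
  have hx : ((2 * x + 1)‼ : ℝ) ≠ 0 := by positivity
  rw [normAmp, B_painleveI hu, normWeight_cons]
  field_simp

theorem geomQuad_normAmp (g k : ℕ) (s : Multiset ℕ) :
    geomQuad (1 / (3 * u)) (normAmp u) g k s = (2 * k + 1)‼ * normWeight u g s *
      (1 / 2 * ∑ᶠ p : ℕ × ℕ, (painleveI u).C k p.1 p.2 * (virLoop (airyM (painleveI u)) g p s +
        virSplit (airyM (painleveI u)) (airyM (painleveI u)) g p s)) := by
  rw [geomQuad, mul_left_comm]
  refine congrArg _ ?_
  rw [mul_finsum]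
  refine finsum_congr fun p => ?_
  have hk : ((2 * k + 1)‼ : ℝ) ≠ 0 := by positivity
  rw [virLoop_normAmp hu, virSplit_normAmp, C_painleveI hu]
  field_simp

theorem geomInit_painleveI (g k : ℕ) (s : Multiset ℕ) :
    geomInit (1 / (3 * u)) g k s = (2 * k + 1)‼ * normWeight u g s * painleveInit u g k s := by
  rcases g with _ | _ | g
  · rcases eq_or_ne s {0, 0} with rfl | hs
    · rcases k with _ | k
      · simp [geomInit, painleveInit, normWeight, oddProd, geomCoeff]
        field_simp
      · simp [geomInit, painleveInit, geomCoeff]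
    · by_cases hk : k = 0 <;> simp [geomInit, painleveInit, hk, hs, -Multiset.insert_eq_cons]
  · rcases eq_or_ne s 0 with rfl | hs
    · have hk : ((2 * k + 1)‼ : ℝ) ≠ 0 := by positivity
      simp [geomInit, painleveInit, normWeight, oddProd, D_painleveI hu]
      field_simp
    · simp [geomInit, painleveInit, hs]
  · simp [geomInit, painleveInit]

theorem isResolvedVirasoro_normAmp : IsResolvedVirasoro (1 / (3 * u)) (normAmp u) where
  unstable k s hs := by rw [normAmp, airyM_zero_of_card_le_one _ k hs, mul_zero, zero_mul]
  rec_eq g k s := by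
    have hmerge : removeSum (geomMerge (1 / (3 * u)) (normAmp u g) k) s =
        (2 * k + 1)‼ * normWeight u g s *
          removeSum (fun x t => ∑ᶠ μ, (painleveI u).B k x μ * airyM (painleveI u) g μ t) s := by
      rw [removeSum_apply, removeSum_apply, ← Multiset.sum_map_mul_left]
      refine congrArg _ (Multiset.map_congr rfl fun x hx => ?_)
      rw [geomMerge_normAmp hu, Multiset.cons_erase hx]
    rw [normAmp, airyM_painleveI_eq hu, airyStep, hmerge, geomQuad_normAmp hu,
      geomInit_painleveI hu]
    ring

theorem isVirasoro_normAmp : IsVirasoro (1 / (3 * u)) (normAmp u) :=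
  (isResolvedVirasoro_normAmp hu).isVirasoro

end NormAmp

/-! ### Bounds on the amplitudes of the Painlevé I curve -/

section PainleveBounds

variable {u v : ℝ}

theorem growthP_pos (hu : 0 < u) : 0 < growthP u := by
  unfold growthP
  split_ifs with h
  · positivity
  · exact div_pos (by norm_num) (by linarith)

theorem growthP_eq (hu : 0 < u) : growthP u = growthRate (1 / (5 * u)) / (2 * u) := by
  unfold growthP growthRate
  split_ifs with h
  · have hhalf : 1 / 2 ≤ 1 / (5 * u) := by
      rw [div_le_div_iff₀ (by norm_num) (by positivity)]
      linarith
    rw [max_eq_left (by linarith), min_eq_right hhalf]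
    field_simp
    norm_num
  · have hhalf : 1 / (5 * u) ≤ 1 / 2 := by
      rw [div_le_div_iff₀ (by positivity) (by norm_num)]
      linarith
    have hden : 5 * u - 1 ≠ 0 := by
      intro h0
      linarith
    rw [max_eq_right (by linarith), min_eq_left hhalf, show 10 * u - 2 = 2 * (5 * u - 1) by ring,
      show 1 - 1 / (5 * u) = (5 * u - 1) / (5 * u) by field_simp]
    field_simp

theorem normAmp_eq (g k : ℕ) (s : Multiset ℕ) : normAmp u g k s =
    airyM (painleveI u) g k s * oddProd (k ::ₘ s) * ((6 * u) ^ (2 * g + s.card) / (6 * u)) := by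
  rw [normAmp, normWeight, oddProd_cons]
  ring

theorem airyM_eq_zero (hu : 0 < u) {g k : ℕ} {s : Multiset ℕ}
    (h : 3 * g + s.card < k + s.sum + 2) : airyM (painleveI u) g k s = 0 := by
  have hzero := (isVirasoro_normAmp hu.ne').vanish g k s h
  have hodd := oddProd_pos (k ::ₘ s)
  have hpow : 0 < (6 * u) ^ (2 * g + s.card) / (6 * u) := by positivity
  rw [normAmp_eq] at hzero
  simpa [hodd.ne', hpow.ne'] using hzero

theorem airyM_nonneg (hu : 0 < u) (g k : ℕ) (s : Multiset ℕ) :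
    0 ≤ airyM (painleveI u) g k s := by
  have hnonneg := (isVirasoro_normAmp hu.ne').nonneg (by positivity) g k s
  rw [normAmp_eq] at hnonneg
  exact nonneg_of_mul_nonneg_left (nonneg_of_mul_nonneg_left hnonneg (by positivity))
    (oddProd_pos _)

/-- The part of the bounds on the amplitudes `F_{g; k₁, …, kₙ}(u)` that depends on `g` and on
`N = 3g - 3 + n`; the scaling parameter `v` is `1` in the first bound of the theorem. -/
def ampBound (u v : ℝ) (g N : ℕ) : ℝ :=
  (2 * u / 27) ^ g * (growthP (u / v) / v ^ 2) ^ N * (N ! / g !)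

theorem ampBound_pos (hu : 0 < u) (hv : 0 < v) (g N : ℕ) : 0 < ampBound u v g N := by
  have := growthP_pos (div_pos hu hv)
  unfold ampBound
  positivity

theorem ampBound_succ (g N : ℕ) :
    ampBound u v g (N + 1) = (N + 1) * (growthP (u / v) / v ^ 2) * ampBound u v g N := by
  rw [ampBound, ampBound, Nat.factorial_succ, pow_succ]
  push_cast
  ring

/-- The function `S` of the theorem. The second factor makes room for the free energies, for which
the recursion is supplemented by one more residue. -/
def amplitudeConst (u : ℝ) : ℝ :=
  growthConst (1 / (5 * u)) / (6 * u) * (1 + 4 * u * growthP u)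

theorem growthConst_pos (hu : 0 < u) : 0 < growthConst (1 / (5 * u)) :=
  lt_of_lt_of_le (by norm_num) (twentySeven_le_growthConst (by positivity))

theorem amplitudeConst_pos (hu : 0 < u) : 0 < amplitudeConst u := by
  have := growthP_pos hu
  have := growthConst_pos hu
  unfold amplitudeConst
  positivity

theorem airyM_mul_oddProd_le (hu : 0 < u) (hv : 0 < v) {g k N : ℕ} {s : Multiset ℕ}
    (hN : k + s.sum ≤ N) (hdim : N + 2 = 3 * g + s.card) :
    airyM (painleveI u) g k s * oddProd (k ::ₘ s) ≤
      v ^ (k + s.sum) * (growthConst (1 / (5 * (u / v))) / (6 * (u / v)) / v *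
        ampBound u v g N) := by
  obtain ⟨ℓ, hℓ⟩ := Nat.exists_eq_add_of_le hN
  have huv : 0 < u / v := by positivity
  have hvir := isVirasoro_normAmp hu.ne'
  rw [show 1 / (3 * u) = 5 * (1 / (5 * u)) / 3 by field_simp] at hvir
  have hle := hvir.le_growth (q' := 1 / (5 * (u / v))) (by positivity) (by positivity) hℓ hdim
  rw [show 1 / (5 * u) / (1 / (5 * (u / v))) = v⁻¹ by field_simp, normAmp_eq, mul_div_assoc',
    div_le_iff₀ (by positivity)] at hle
  set d := k + s.sum
  set G := growthConst (1 / (5 * (u / v)))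
  set p := growthRate (1 / (5 * (u / v))) with hp
  have hrate : growthP (u / v) / v ^ 2 = 3 * p * v⁻¹ / (6 * u) := by
    rw [growthP_eq huv, ← hp]
    field_simp
    ring
  have hscale : v⁻¹ ^ N * v ^ d = v⁻¹ ^ ℓ := by
    rw [hℓ, pow_add, mul_right_comm, ← mul_pow, inv_mul_cancel₀ hv.ne', one_pow, one_mul]
  have hpow : (6 * u) ^ (2 * g + s.card) * (6 * u) ^ g / ((6 * u) ^ N * (6 * u)) = 6 * u := by
    rw [← pow_add, show 2 * g + s.card + g = N + 2 by omega, pow_add]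
    field_simp
  refine le_of_mul_le_mul_right (hle.trans_eq ?_)
    (show 0 < (6 * u) ^ (2 * g + s.card) by positivity)
  rw [ampBound, hrate, ← hscale, show 2 * u / 27 = 1 / 81 * (6 * u) by ring,
    show G / (6 * (u / v)) / v = G / (6 * u) by field_simp]
  generalize 6 * u = c at *
  linear_combination -(G * v⁻¹ ^ N * v ^ d * (3 ^ N * p ^ N) * ((1 / 81) ^ g * (N ! / g !))) * hpow

/-! ### The free energies -/

theorem primitive_monomial {K : Type*} [Field K] (n : ℕ) (c : K) :
    primitive (PowerSeries.monomial n c) = PowerSeries.monomial (n + 1) (c / (n + 1 : K)) := by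
  ext m
  rcases m with - | m
  · simp [primitive, PowerSeries.coeff_monomial]
  · rw [coeff_succ_primitive, PowerSeries.coeff_monomial, PowerSeries.coeff_monomial]
    by_cases h : m = n
    · simp [h]
    · simp [h]

theorem primitive_sub {K : Type*} [Field K] (f h : PowerSeries K) :
    primitive (f - h) = primitive f - primitive h := by
  ext m
  rcases m with - | m
  · simp [primitive]
  · simp only [coeff_succ_primitive, map_sub, sub_div]

theorem residue_sub {K : Type*} [Field K] (f h : LaurentSeries K) :
    residue (f - h) = residue f - residue h :=
  HahnSeries.coeff_sub

theorem primitive_y_mul_derivative_x_painleveI (u : ℝ) :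
    primitive ((painleveI u).y * derivative ℝ (painleveI u).x) =
      PowerSeries.monomial 5 (2 / 5) - PowerSeries.monomial 3 (2 * u) := by
  have hform : (painleveI u).y * derivative ℝ (painleveI u).x =
      PowerSeries.monomial 4 2 - PowerSeries.monomial 2 (6 * u) := by
    rw [LocalSpectralCurve.derivative_x, painleveI, PowerSeries.monomial_eq_C_mul_X_pow,
      PowerSeries.monomial_eq_C_mul_X_pow, map_mul, map_mul, map_ofNat, map_ofNat, map_ofNat]
    ring
  rw [hform, primitive_sub, primitive_monomial, primitive_monomial]
  congr 2
  · norm_num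
  · push_cast
    ring

theorem coeff_omega1_painleveI (hu : 0 < u) (g j : ℕ) :
    (omega1 (painleveI u) g).coeff (-(2 * (j : ℤ) + 2)) =
      airyM (painleveI u) g j 0 * oddProd {j} := by
  have hterm : ∀ k, airyAmplitude (painleveI u) g [k] = airyM (painleveI u) g k 0 :=
    fun k => airyAmplitude_eq_airyM _ g k []
  have hsupport : (fun k => airyAmplitude (painleveI u) g [k] • (painleveI u).xi k).support ⊆
      Finset.range (3 * g + j + 1) := by
    refine Function.support_subset_iff'.2 fun k hk => ?_
    rw [Finset.mem_coe, Finset.mem_range] at hk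
    rw [hterm, airyM_eq_zero hu (by simp; omega)]
    exact zero_smul ℝ ((painleveI u).xi k)
  rw [omega1, finsum_eq_finsetSum_of_support_subset _ hsupport, HahnSeries.coeff_sum,
    Finset.sum_eq_single_of_mem j (by simp) fun k _ hk => by
      rw [HahnSeries.coeff_smul, xi_painleveI, HahnSeries.coeff_single_of_ne (by omega), smul_zero],
    HahnSeries.coeff_smul, xi_painleveI, HahnSeries.coeff_single_same, hterm, smul_eq_mul]
  simp [oddProd]

theorem freeEnergy_painleveI (hu : 0 < u) (g : ℕ) : freeEnergy (painleveI u) g =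
    1 / (2 - 2 * (g : ℝ)) * (2 / 5 * (airyM (painleveI u) g 2 0 * oddProd {2}) -
      2 * u * (airyM (painleveI u) g 1 0 * oddProd {1})) := by
  rw [freeEnergy, primitive_y_mul_derivative_x_painleveI, mul_comm _ (omega1 _ _), map_sub,
    ofPowerSeries_monomial, ofPowerSeries_monomial, mul_sub, residue_sub, residue_mul_single,
    residue_mul_single, ← coeff_omega1_painleveI hu, ← coeff_omega1_painleveI hu,
    mul_comm (2 / 5), mul_comm (2 * u)]
  rfl

theorem freeEnergy_painleveI_le (hu : 0 < u) {g : ℕ} (hg : 2 ≤ g) {R : ℝ} (hR : 0 ≤ R)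
    (hle : airyM (painleveI u) g 1 0 * oddProd {1} ≤ (3 * g - 2) * R) :
    freeEnergy (painleveI u) g ≤ 4 * u * R := by
  have hnonneg := mul_nonneg (airyM_nonneg hu g 2 0) (oddProd_pos {2}).le
  have hg' : (2 : ℝ) ≤ g := by exact_mod_cast hg
  have hgenus : (3 * g - 2) * R ≤ 2 * (2 * g - 2) * R := by
    gcongr
    linarith
  rw [freeEnergy_painleveI hu, show (2 : ℝ) - 2 * g = -(2 * g - 2) by ring, one_div_mul_eq_div,
    div_neg, ← neg_div, div_le_iff₀ (by linarith)]
  calc _ ≤ 2 * u * (airyM (painleveI u) g 1 0 * oddProd {1}) := by linarith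
    _ ≤ 2 * u * (2 * (2 * g - 2) * R) := by
      exact mul_le_mul_of_nonneg_left (hle.trans hgenus) (by positivity)
    _ = 4 * u * R * (2 * g - 2) := by ring

/-! ### All amplitudes -/

theorem amplitude_painleveI_succ (g : ℕ) {n : ℕ} (k : Fin (n + 1) → ℕ) :
    ∃ s : Multiset ℕ, s.card = n ∧ ∑ i, k i = k 0 + s.sum ∧
      amplitude (painleveI u) g k * ∏ i, ((2 * k i + 1)‼ : ℝ) =
        airyM (painleveI u) g (k 0) s * oddProd (k 0 ::ₘ s) := by
  refine ⟨(List.ofFn fun i : Fin n => k i.succ : List ℕ), by simp, ?_, ?_⟩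
  · rw [Fin.sum_univ_succ, Multiset.sum_coe, List.sum_ofFn]
  · rw [amplitude, if_neg n.succ_ne_zero, List.ofFn_succ, airyAmplitude_eq_airyM, oddProd_cons,
      oddProd, Multiset.map_coe, Multiset.prod_coe, List.map_ofFn, List.prod_ofFn,
      Fin.prod_univ_succ]
    rfl

theorem amplitude_painleveI_eq_zero (hu : 0 < u) {g n N : ℕ} (hN : 3 * g + n = N + 3)
    {k : Fin n → ℕ} (hk : N < ∑ i, k i) :
    amplitude (painleveI u) g k * ∏ i, ((2 * k i + 1)‼ : ℝ) = 0 := by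
  rcases n with - | n
  · simp at hk
  · obtain ⟨s, hcard, hsum, hamp⟩ := amplitude_painleveI_succ (u := u) g k
    rw [hamp, airyM_eq_zero hu (by omega), zero_mul]

theorem freeEnergy_painleveI_le_ampBound (hu : 0 < u) (hv : 0 < v) {g N : ℕ}
    (hN : 3 * g = N + 3) (hg : 2 ≤ g) :
    freeEnergy (painleveI u) g ≤ amplitudeConst (u / v) / v * ampBound u v g N := by
  have huv : 0 < u / v := by positivity
  have hP := growthP_pos huv
  have hconst := growthConst_pos huv
  have hbound := ampBound_pos hu hv g N
  have hN' : (3 * g - 2 : ℝ) = N + 1 := by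
    have : (3 * g : ℝ) = N + 3 := by exact_mod_cast hN
    linarith
  have hle := airyM_mul_oddProd_le hu hv (g := g) (k := 1) (s := 0) (N := N + 1) (by simp)
    (by simp; omega)
  rw [ampBound_succ] at hle
  set T := growthConst (1 / (5 * (u / v))) / (6 * (u / v))
  calc freeEnergy (painleveI u) g
      ≤ 4 * u * (T * (growthP (u / v) / v ^ 2) * ampBound u v g N) := by
        refine freeEnergy_painleveI_le hu hg (by positivity) (hle.trans_eq ?_)
        rw [hN', Multiset.sum_zero, add_zero, pow_one]
        field_simp
    _ = 4 * (u / v) * growthP (u / v) * (T / v * ampBound u v g N) := by field_simp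
    _ ≤ (1 + 4 * (u / v) * growthP (u / v)) * (T / v * ampBound u v g N) := by
        gcongr
        linarith
    _ = _ := by
        rw [amplitudeConst]
        ring

theorem amplitude_painleveI_le (hu : 0 < u) (hv : 0 < v) {g n N : ℕ} (hN : 3 * g + n = N + 3)
    (hgn : 2 < 2 * g + n) (k : Fin n → ℕ) :
    amplitude (painleveI u) g k * ∏ i, ((2 * k i + 1)‼ : ℝ) ≤
      v ^ (∑ i, k i) * (amplitudeConst (u / v) / v * ampBound u v g N) := by
  have huv : 0 < u / v := by positivity
  have hbound := ampBound_pos hu hv g N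
  have hconst := amplitudeConst_pos huv
  rcases n with - | n
  · simpa [amplitude] using freeEnergy_painleveI_le_ampBound hu hv hN (by omega)
  · rcases lt_or_ge N (∑ i, k i) with hk | hk
    · rw [amplitude_painleveI_eq_zero hu hN hk]
      positivity
    obtain ⟨s, hcard, hsum, hamp⟩ := amplitude_painleveI_succ (u := u) g k
    rw [hamp, hsum]
    refine (airyM_mul_oddProd_le hu hv (hsum ▸ hk) (by omega)).trans ?_
    have := growthP_pos huv
    have := growthConst_pos huv
    unfold amplitudeConst
    gcongr
    exact le_mul_of_one_le_right (by positivity) (le_add_of_nonneg_right (by positivity))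

theorem exists_finset_card_le_choose (n N : ℕ) : ∃ D : Finset (Fin n → ℕ),
    (∀ k ∉ D, N < ∑ i, k i) ∧ D.card ≤ (N + n).choose n := by
  refine ⟨((Finset.univ : Finset (Fin (n + 1))).finsuppAntidiag N).image fun f i => f i.succ,
    fun k hk => ?_, Finset.card_image_le.trans_eq ?_⟩
  · contrapose! hk
    refine Finset.mem_image.2 ⟨Finsupp.equivFunOnFinite.symm (Fin.cons (N - ∑ i, k i) k), ?_, ?_⟩
    · rw [Finset.mem_finsuppAntidiag]
      exact ⟨by simp [Fin.sum_univ_succ, hk], Finset.subset_univ _⟩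
    · ext i
      simp
  · rw [Finset.card_finsuppAntidiag_nat_eq_choose, Finset.card_univ, Fintype.card_fin,
      show n + 1 + N - 1 = N + n by omega, Nat.choose_symm_add]

theorem summable_and_tsum_le_choose_mul {n N : ℕ} {f : (Fin n → ℕ) → ℝ} {R : ℝ} (hR : 0 ≤ R)
    (hzero : ∀ k, N < ∑ i, k i → f k = 0) (hle : ∀ k, f k ≤ R) :
    Summable f ∧ ∑' k, f k ≤ (N + n).choose n * R := by
  obtain ⟨D, hD, hcard⟩ := exists_finset_card_le_choose n N
  have hsupport : ∀ k ∉ D, f k = 0 := fun k hk => hzero k (hD k hk)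
  refine ⟨summable_of_ne_finset_zero hsupport, ?_⟩
  calc ∑' k, f k = ∑ k ∈ D, f k := tsum_eq_sum hsupport
    _ ≤ D.card • R := Finset.sum_le_card_nsmul _ _ _ fun k _ => hle k
    _ = D.card * R := nsmul_eq_mul _ _
    _ ≤ (N + n).choose n * R := by gcongr

theorem choose_mul_ampBound (u v : ℝ) (g n N : ℕ) : (N + n).choose n * ampBound u v g N =
    (2 * u / 27) ^ g * (growthP (u / v) / v ^ 2) ^ N * ((N + n)! / (g ! * n !)) := by
  have hchoose : ((N + n)! : ℝ) = (N + n).choose n * N ! * n ! := by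
    exact_mod_cast (Nat.add_choose_mul_factorial_mul_factorial N n).symm
  rw [ampBound, hchoose]
  field_simp

end PainleveBounds

end

end TopRec

theorem mainTheorem7 :
    ∃ S : ℝ → ℝ,
      (∀ u : ℝ, 0 < u → 0 < S u) ∧
      (∀ u : ℝ, 0 < u → ∀ g n : ℕ, 2 < 2 * g + n → ∀ k : Fin n → ℕ,
        TopRec.amplitude (TopRec.painleveI u) g k *
            ∏ i, (Nat.doubleFactorial (2 * k i + 1) : ℝ) ≤
          S u * (2 * u / 27) ^ g * TopRec.growthP u ^ (3 * g + n - 3) *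
            ((Nat.factorial (3 * g + n - 3) : ℝ) / (Nat.factorial g : ℝ))) ∧
      (∀ u v : ℝ, 0 < u → 0 < v → ∀ g n : ℕ, 2 < 2 * g + n →
        Summable (fun k : Fin n → ℕ =>
          (v ^ (∑ i, k i))⁻¹ * TopRec.amplitude (TopRec.painleveI u) g k *
            ∏ i, (Nat.doubleFactorial (2 * k i + 1) : ℝ)) ∧
        ∑' k : Fin n → ℕ,
          (v ^ (∑ i, k i))⁻¹ * TopRec.amplitude (TopRec.painleveI u) g k *
            ∏ i, (Nat.doubleFactorial (2 * k i + 1) : ℝ) ≤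
          S (u / v) / v * (2 * u / 27) ^ g *
            (TopRec.growthP (u / v) / v ^ 2) ^ (3 * g + n - 3) *
            ((Nat.factorial (3 * g + 2 * n - 3) : ℝ) /
              ((Nat.factorial g : ℝ) * (Nat.factorial n : ℝ)))) := by
  refine ⟨TopRec.amplitudeConst, fun u hu => TopRec.amplitudeConst_pos hu,
    fun u hu g n hgn k => ?_, fun u v hu hv g n hgn => ?_⟩
  · have hle := TopRec.amplitude_painleveI_le hu one_pos (N := 3 * g + n - 3) (by omega) hgn k
    simpa [TopRec.ampBound, mul_assoc] using hle
  · obtain ⟨N, hN⟩ : ∃ N, 3 * g + n = N + 3 := ⟨3 * g + n - 3, by omega⟩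
    have hS := TopRec.amplitudeConst_pos (div_pos hu hv)
    have hbound := TopRec.ampBound_pos hu hv g N
    rw [show 3 * g + n - 3 = N by omega, show 3 * g + 2 * n - 3 = N + n by omega,
      mul_assoc (_ / v), mul_assoc (_ / v), ← TopRec.choose_mul_ampBound, mul_left_comm]
    refine TopRec.summable_and_tsum_le_choose_mul (by positivity) (fun k hk => ?_) fun k => ?_
    · rw [mul_assoc, TopRec.amplitude_painleveI_eq_zero hu hN hk, mul_zero]
    · rw [mul_assoc, inv_mul_le_iff₀ (by positivity)]
      exact TopRec.amplitude_painleveI_le hu hv hN hgn k
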